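/- Theorem (Off-to-on Bayesian regret bound for vanilla IDS). Model. Fix $H,d,T\ge 1$, measurable state and action spaces $\mathcal S,\mathcal A$, an initial law $\rho$ on $\mathcal S$, known transition kernels $P_1,\dots,P_H$ from $\mathcal S\times\mathcal A$ to $\mathcal S$, and a known measurable feature map $\phi:\mathcal S\times\mathcal A\to\mathbb R^d$ with $\|\phi\|_2\le 1$. The unknown parameter is $w=(w_1,\dots,w_H)$ with independent $w_h\sim\mathcal N(0,\lambda^{-1}I_d)$ and known $\lambda\ge 1$. Visiting $(s,a)$ at stage $h$ yields the observation $y=\langle\phi(s,a),w_h\rangle+\varepsilon$ with independent $\varepsilon\sim\mathcal N(0,1)$. The mean reward is $g(\langle\phi(s,a),w_h\rangle)$ for a fixed $1$-Lipschitz $g:\mathbb R\to\mathbb R$ ($g=\mathrm{id}$ is the linear reward; $g=$ clipping to $[0,1]$ keeps mean rewards in $[0,1]$). $V_1^\pi(s;w)$ is the expected sum of the $H$ mean rewards of the Markov policy $\pi$ from $s_1=s$, and $w\mapsto\pi^*_w$ is a measurable choice of optimal policies. Let $\Pi$ be the set of all episode-level mixtures of policies from a class of Markov policies that contains every $\pi^*_w$;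 values of mixtures are the averaged values. Data. An arbitrary offline data set $\mathcal D_N$ of triples (state, action, observation) is given, with $n_h\ge 1$ samples at stage $h$ and $N=\sum_h n_h$; let $\Lambda_{h,N}=\lambda I+\sum_{(s,a)\in\mathcal D_{N,h}}\phi(s,a)\phi(s,a)^\top$. Conditionally on $\mathcal D_N$, $w$ has its Bayes posterior law; write $\mathbb E^{\mathrm{off}}$ for expectation under the resulting conditional law of $w$ and of $T$ online episodes with trajectories $\tau_t=(s_{t,h},a_{t,h},y_{t,h})_{h\le H}$ together with $s_{t,H+1}$. Let $\mathcal H_t=\sigma(\mathcal D_N,\tau_1,\dots,\tau_{t-1})$. For $\pi\in\Pi$, let $\Delta_t(\pi)=\mathbb E[V_1^{\pi^*_w}(s_{t,1};w)-V_1^{\pi}(s_{t,1};w)\mid\mathcal H_t]$ and let $I_t(\pi)=I(w;\tau_t\mid\mathcal H_t,\pi_t=\pi)$ be the mutual information between $w$ and the trajectory under the posterior given $\mathcal H_t$. Algorithm. Vanilla $\mathrm{IDS}_0$ is any rule whose policy $\pi_t\in\Pi$ depends measurably on the history and, almost surely, minimises $\Delta_t(\pi)^2/I_t(\pi)$ over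 $\Pi$ for every $t\le T$, with the conventions $x/0=+\infty$ for $x>0$ and $0/0=0$. Conclusion. For every such rule, each $\Delta_t(\pi_t)$, $t\le T$, is integrable given $\mathcal D_N$, and $$\mathbb E^{\mathrm{off}}\Big[\sum_{t=1}^T\Delta_t(\pi_t)\Big]\le\sqrt{\tfrac{2}{\log 2}}\;Hd\,\min\Big\{\sqrt{T\,L_N(T)},\;T\sqrt{C^\dagger(N,T)/N}\Big\},$$ where $L_N(T)=\frac1H\sum_{h=1}^H\log\big(1+\tfrac{T}{d\,\lambda_{\min}(\Lambda_{h,N})}\big)$, and, with the visitation covariance of the rule itself $\overline\Sigma_{h,T}=\frac1T\sum_{t=1}^T\mathbb E^{\mathrm{off}}[\phi_{t,h}\phi_{t,h}^\top]$, $\phi_{t,h}=\phi(s_{t,h},a_{t,h})$, $$C^\dagger(N,T)=\frac NH\sum_{h=1}^H\frac1{n_h}\,\lambda_{\max}\Big((\Lambda_{h,N}/n_h)^{-1/2}\,\overline\Sigma_{h,T}\,(\Lambda_{h,N}/n_h)^{-1/2}\Big).$$ In particular the Bayesian regret is $\widetilde O\big(Hd\min\{\sqrt{T L_N(T)},\,T\sqrt{C^\dagger(N,T)/N}\}\big)$,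 with a universal constant and no hidden logarithmic factor. -/

import Mathlib

open MeasureTheory ProbabilityTheory Matrix
open scoped NNReal ENNReal BigOperators MatrixOrder unitInterval

noncomputable section

namespace OffToOn

/-- The parameter space: one vector `w_h` of `ℝ^d` for every stage `h`. -/
abbrev Param (H d : ℕ) : Type := Fin H → EuclideanSpace ℝ (Fin d)

/-- A `k`-stage trajectory `(s_1, a_1, y_1, …, s_k, a_k, y_k, s_{k+1})`: the `k` triples
(state, action, scalar observation) and the state reached after the last of them. -/
abbrev Traj (S A : Type*) (k : ℕ) := (Fin k → S × A × ℝ) × S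

/-- The online history before episode `t` (episodes are numbered from `0`): `t` trajectories. -/
abbrev Hist (S A : Type*) (H t : ℕ) := Fin t → Traj S A H

/-- The known part of the model: initial law, transition kernels, feature map, and the map `link`
from the linear predictor `⟨φ(s,a), w_h⟩` to the mean reward.  `link = id` is the linear reward;
clipping to `[0,1]` is the version with rewards bounded in `[0,1]`. -/
structure Model (S A : Type*) [MeasurableSpace S] [MeasurableSpace A] (H d : ℕ) where
  init : Measure S
  isProb_init : IsProbabilityMeasure init
  trans : Fin H → Kernel (S × A) S
  isMarkov_trans : ∀ h, IsMarkovKernel (trans h)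
  feat : S × A → EuclideanSpace ℝ (Fin d)
  measurable_feat : Measurable feat
  norm_feat_le : ∀ x, ‖feat x‖ ≤ 1
  link : ℝ → ℝ
  lipschitz_link : LipschitzWith 1 link

attribute [instance] Model.isProb_init Model.isMarkov_trans

/-- A Markov policy `π = (π_1, …, π_H)`, `π_h : S → Δ(A)`, depending measurably on a context
`z : Z` which is fixed during the episode. -/
structure CtxPolicy (Z S A : Type*) [MeasurableSpace Z] [MeasurableSpace S] [MeasurableSpace A]
    (H : ℕ) where
  act : Fin H → Kernel (Z × S) A
  isMarkov_act : ∀ h, IsMarkovKernel (act h)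

attribute [instance] CtxPolicy.isMarkov_act

variable {S A Z Z' : Type*} [MeasurableSpace S] [MeasurableSpace A] [MeasurableSpace Z]
  [MeasurableSpace Z'] {H d : ℕ}

/-- Change of context along a measurable map. -/
def CtxPolicy.comap (π : CtxPolicy Z S A H) (f : Z' → Z) (hf : Measurable f) :
    CtxPolicy Z' S A H where
  act h := (π.act h).comap (fun x : Z' × S => (f x.1, x.2)) (by fun_prop)
  isMarkov_act h := inferInstance

/-- A plain Markov policy. -/
abbrev MarkovPolicy (S A : Type*) [MeasurableSpace S] [MeasurableSpace A] (H : ℕ) :=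
  CtxPolicy Unit S A H

/-- An episode-level randomised policy: a seed `u`, uniform on `[0,1]`, is drawn once at the start
of the episode and the Markov policy selected by `u` is then played.  Every mixture of Markov
policies over a standard Borel index space has this form. -/
abbrev RandPolicy (S A : Type*) [MeasurableSpace S] [MeasurableSpace A] (H : ℕ) :=
  CtxPolicy I S A H

/-- The Markov policy played in context `z`. -/
def CtxPolicy.at (π : CtxPolicy Z S A H) (z : Z) : MarkovPolicy S A H :=
  π.comap (fun _ => z) measurable_const

/-- The randomised closure of a class of Markov policies: all its episode-level mixtures. -/
def randClosure (C : Set (MarkovPolicy S A H)) : Set (RandPolicy S A H) :=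
  {π | ∀ u, π.at u ∈ C}

/-! ### Trajectories -/

lemma measurable_linPred (M : Model S A H d) (k : Fin H) :
    Measurable (fun x : Param H d × (S × A) => inner ℝ (M.feat x.2) (x.1 k)) := by
  have := M.measurable_feat
  fun_prop

/-- The observation `y = ⟨φ(s,a), w_k⟩ + ε`, `ε ∼ N(0,1)`. -/
def obsKernel (M : Model S A H d) (k : Fin H) : Kernel (Param H d × (S × A)) ℝ :=
  ((Kernel.deterministic _ (measurable_linPred M k)) ×ₖ
    (Kernel.const _ (gaussianReal 0 1))).map (fun p : ℝ × ℝ => p.1 + p.2)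

instance (M : Model S A H d) (k : Fin H) : IsMarkovKernel (obsKernel M k) := by
  unfold obsKernel
  exact Kernel.IsMarkovKernel.map _ (by fun_prop)

/-- Append one stage: action, observation and next state. -/
def extend (k : ℕ) (x : Traj S A k × (A × (ℝ × S))) : Traj S A (k + 1) :=
  (Fin.snoc (α := fun _ => S × A × ℝ) x.1.1 (x.1.2, x.2.1, x.2.2.1), x.2.2.2)

lemma measurable_snoc {X : Type*} [MeasurableSpace X] (k : ℕ) :
    Measurable (fun x : (Fin k → X) × X => Fin.snoc (α := fun _ => X) x.1 x.2) := by
  refine measurable_pi_iff.2 fun i => ?_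
  induction i using Fin.lastCases with
  | last => simpa using measurable_snd
  | cast i => simpa using measurable_fst.eval

lemma measurable_extend (k : ℕ) : Measurable (extend (S := S) (A := A) k) := by
  unfold extend
  refine Measurable.prodMk ?_ (by fun_prop)
  exact (measurable_snoc (X := S × A × ℝ) k).comp
    (g := fun x : (Fin k → S × A × ℝ) × (S × A × ℝ) => Fin.snoc (α := fun _ => S × A × ℝ) x.1 x.2)
    (f := fun x : Traj S A k × (A × (ℝ × S)) => (x.1.1, (x.1.2, x.2.1, x.2.2.1))) (by fun_prop)

/-- One stage, given `((w, z), s₁)` and the trajectory so far: draw `a ∼ π_k(z, s)`, then,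
independently given `(s, a)`, the observation `y` and the next state `s' ∼ P_k(s, a)`. -/
def stageKernel (M : Model S A H d) (π : CtxPolicy Z S A H) (j : ℕ) (k : Fin H) :
    Kernel (((Param H d × Z) × S) × Traj S A j) (A × (ℝ × S)) :=
  ((π.act k).comap
      (fun x : ((Param H d × Z) × S) × Traj S A j => (x.1.1.2, x.2.2)) (by fun_prop)) ⊗ₖ
    (((obsKernel M k).comap
        (fun x : (((Param H d × Z) × S) × Traj S A j) × A => (x.1.1.1.1, (x.1.2.2, x.2)))
        (by fun_prop)) ×ₖ
      ((M.trans k).comap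
        (fun x : (((Param H d × Z) × S) × Traj S A j) × A => (x.1.2.2, x.2)) (by fun_prop)))

instance (M : Model S A H d) (π : CtxPolicy Z S A H) (j : ℕ) (k : Fin H) :
    IsMarkovKernel (stageKernel M π j k) := by
  unfold stageKernel
  infer_instance

/-- Law of the first `k` stages from the initial state `s` in context `z` under parameter `w`. -/
def rollout (M : Model S A H d) (π : CtxPolicy Z S A H) :
    (k : ℕ) → k ≤ H → Kernel ((Param H d × Z) × S) (Traj S A k)
  | 0, _ => Kernel.deterministic (fun x => (Fin.elim0, x.2)) (by fun_prop)
  | k + 1, hk =>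
      ((rollout M π k (Nat.le_of_succ_le hk)) ⊗ₖ (stageKernel M π k ⟨k, hk⟩)).map (extend k)

instance (M : Model S A H d) (π : CtxPolicy Z S A H) (k : ℕ) (hk : k ≤ H) :
    IsMarkovKernel (rollout M π k hk) := by
  induction k with
  | zero => unfold rollout; infer_instance
  | succ k ih =>
    unfold rollout
    have := ih (Nat.le_of_succ_le hk)
    exact Kernel.IsMarkovKernel.map _ (measurable_extend k)

/-- Law of an episode, with `s₁` drawn from the initial law. -/
def episode (M : Model S A H d) (π : CtxPolicy Z S A H) :
    Kernel (Param H d × Z) (Traj S A H) :=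
  (rollout M π H le_rfl) ∘ₖ (Kernel.id ×ₖ Kernel.const _ M.init)

instance (M : Model S A H d) (π : CtxPolicy Z S A H) : IsMarkovKernel (episode M π) := by
  unfold episode
  infer_instance

/-- Law of an episode under a randomised policy (the seed is not part of the trajectory). -/
def randEpisode (M : Model S A H d) (π : RandPolicy S A H) :
    Kernel (Param H d) (Traj S A H) :=
  (episode M π) ∘ₖ (Kernel.id ×ₖ Kernel.const _ (volume : Measure I))

instance (M : Model S A H d) (π : RandPolicy S A H) : IsMarkovKernel (randEpisode M π) := by
  unfold randEpisode
  infer_instance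

/-- The feature vector `φ_h = φ(s_h, a_h)` at stage `h` of a trajectory. -/
def featAt (M : Model S A H d) (τ : Traj S A H) (h : Fin H) : EuclideanSpace ℝ (Fin d) :=
  M.feat ((τ.1 h).1, (τ.1 h).2.1)

/-- The value `V_1^{π(z)}(s; w)`: expected sum of the `H` mean rewards from the initial state `s`,
when the Markov policy selected by the context `z` is played under the parameter `w`. -/
def value (M : Model S A H d) (π : CtxPolicy Z S A H) (z : Z) (w : Param H d) (s : S) : ℝ :=
  ∫ τ, ∑ h, M.link (inner ℝ (featAt M τ h) (w h)) ∂(rollout M π H le_rfl ((w, z), s))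

/-- `w ↦ π*_w` is a (measurable) choice of optimal policies. -/
def IsOptimalFamily (M : Model S A H d) (πs : CtxPolicy (Param H d) S A H) : Prop :=
  ∀ (w : Param H d) (π : MarkovPolicy S A H) (s : S), value M π () w s ≤ value M πs w w s

/-! ### Offline phase -/

/-- The prior: independent `w_h ∼ N(0, lam⁻¹ I)`. -/
def prior (H d : ℕ) (lam : ℝ) : Measure (Param H d) :=
  Measure.pi (fun _ => multivariateGaussian 0 (lam⁻¹ • (1 : Matrix (Fin d) (Fin d) ℝ)))

instance (H d : ℕ) (lam : ℝ) : IsProbabilityMeasure (prior H d lam) := by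
  unfold prior
  infer_instance

/-- An offline data set: `n h` triples (state, action, observation) for every stage `h`. -/
structure Dataset (S A : Type*) (H : ℕ) where
  n : Fin H → ℕ
  data : (h : Fin H) → Fin (n h) → S × A × ℝ

/-- The total number `N` of offline samples. -/
def Dataset.size (D : Dataset S A H) : ℕ := ∑ h, D.n h

/-- Feature vector of the `i`-th offline sample at stage `h`. -/
def offFeat (M : Model S A H d) (D : Dataset S A H) (h : Fin H) (i : Fin (D.n h)) :
    EuclideanSpace ℝ (Fin d) :=
  M.feat ((D.data h i).1, (D.data h i).2.1)

/-- Log-likelihood of the offline observations under unit-variance Gaussian noise, up to an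
additive constant. -/
def logLik (M : Model S A H d) (D : Dataset S A H) (w : Param H d) : ℝ :=
  -(1 / 2) * ∑ h, ∑ i, ((D.data h i).2.2 - inner ℝ (offFeat M D h i) (w h)) ^ 2

/-- The posterior law of `w` given the offline data: the prior reweighted by the likelihood and
normalised. -/
def offPosterior (M : Model S A H d) (lam : ℝ) (D : Dataset S A H) : Measure (Param H d) :=
  (prior H d lam).tilted (logLik M D)

instance (M : Model S A H d) (lam : ℝ) (D : Dataset S A H) :
    IsProbabilityMeasure (offPosterior M lam D) := by
  unfold offPosterior
  refine isProbabilityMeasure_tilted ?_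
  have hm : Measurable (logLik M D) := by
    unfold logLik
    fun_prop
  refine Integrable.of_bound (C := 1) (by fun_prop) (Filter.Eventually.of_forall fun w => ?_)
  have h0 : 0 ≤ ∑ h, ∑ i, ((D.data h i).2.2 - inner ℝ (offFeat M D h i) (w h)) ^ 2 :=
    Finset.sum_nonneg fun h _ => Finset.sum_nonneg fun i _ => sq_nonneg _
  rw [Real.norm_eq_abs, Real.abs_exp, Real.exp_le_one_iff]
  unfold logLik
  linarith

/-- The offline Gram matrix `Λ_{h,N} = lam I + ∑ φ φᵀ`. -/
def gram (M : Model S A H d) (lam : ℝ) (D : Dataset S A H) (h : Fin H) :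
    Matrix (Fin d) (Fin d) ℝ :=
  lam • (1 : Matrix (Fin d) (Fin d) ℝ) +
    ∑ i, vecMulVec (fun j => offFeat M D h i j) (fun j => offFeat M D h i j)

/-! ### Online phase -/

/-- An online learning rule: for each episode a randomised policy that depends measurably on the
history. -/
abbrev Algorithm (S A : Type*) [MeasurableSpace S] [MeasurableSpace A] (H : ℕ) :=
  (t : ℕ) → CtxPolicy (Hist S A H t × I) S A H

/-- The randomised policy that the rule plays in episode `t` after the history `η`. -/
def playedPolicy (alg : Algorithm S A H) (t : ℕ) (η : Hist S A H t) : RandPolicy S A H :=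
  (alg t).comap (fun u => (η, u)) (by fun_prop)

/-- Law of the trajectory of episode `t` given the parameter and the history. -/
def onlineKernel (M : Model S A H d) (alg : Algorithm S A H) (t : ℕ) :
    Kernel (Param H d × Hist S A H t) (Traj S A H) :=
  (episode M (alg t)) ∘ₖ
    ((Kernel.id ×ₖ Kernel.const _ (volume : Measure I)).map MeasurableEquiv.prodAssoc)

instance (M : Model S A H d) (alg : Algorithm S A H) (t : ℕ) :
    IsMarkovKernel (onlineKernel M alg t) := by
  unfold onlineKernel
  have : IsMarkovKernel ((Kernel.id ×ₖ Kernel.const (Param H d × Hist S A H t)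
      (volume : Measure I)).map MeasurableEquiv.prodAssoc) :=
    Kernel.IsMarkovKernel.map _ (MeasurableEquiv.measurable _)
  infer_instance

/-- The law, given the offline data, of the pair (parameter, history before episode `t`). -/
def jointLaw (M : Model S A H d) (lam : ℝ) (D : Dataset S A H) (alg : Algorithm S A H) :
    (t : ℕ) → Measure (Param H d × Hist S A H t)
  | 0 => (offPosterior M lam D).map (fun w => (w, Fin.elim0))
  | t + 1 => ((jointLaw M lam D alg t) ⊗ₘ (onlineKernel M alg t)).map
      (fun x => (x.1.1, Fin.snoc (α := fun _ => Traj S A H) x.1.2 x.2))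

instance (M : Model S A H d) (lam : ℝ) (D : Dataset S A H) (alg : Algorithm S A H) (t : ℕ) :
    IsProbabilityMeasure (jointLaw M lam D alg t) := by
  induction t with
  | zero =>
    unfold jointLaw
    exact Measure.isProbabilityMeasure_map (by fun_prop)
  | succ t ih =>
    unfold jointLaw
    refine Measure.isProbabilityMeasure_map (Measurable.aemeasurable ?_)
    refine Measurable.prodMk (by fun_prop) ?_
    exact (measurable_snoc (X := Traj S A H) t).comp
      (g := fun x : (Fin t → Traj S A H) × Traj S A H =>
        Fin.snoc (α := fun _ => Traj S A H) x.1 x.2)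
      (f := fun x : (Param H d × Hist S A H t) × Traj S A H => (x.1.2, x.2)) (by fun_prop)

/-- The law, given the offline data, of the history before episode `t`. -/
def histLaw (M : Model S A H d) (lam : ℝ) (D : Dataset S A H) (alg : Algorithm S A H) (t : ℕ) :
    Measure (Hist S A H t) :=
  (jointLaw M lam D alg t).map Prod.snd

/-- The posterior `β_t = P(w ∈ · | 𝓗_t)`: the regular conditional law of the parameter given the
history (and the fixed offline data). -/
def posteriorAt (M : Model S A H d) (lam : ℝ) (D : Dataset S A H) (alg : Algorithm S A H)
    (t : ℕ) : Kernel (Hist S A H t) (Param H d) :=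
  condDistrib Prod.fst Prod.snd (jointLaw M lam D alg t)

/-! ### Regret, information gain, information-directed sampling -/

/-- Expected one-episode regret `Δ(π)` when the parameter has law `β`. -/
def regret (M : Model S A H d) (πs : CtxPolicy (Param H d) S A H) (β : Measure (Param H d))
    (π : RandPolicy S A H) : ℝ :=
  ∫ w, ∫ s, (value M πs w w s - ∫ u : I, value M π u w s) ∂M.init ∂β

/-- Mutual information `I(w; τ)` between the parameter and the trajectory of an episode played
with `π`, when the parameter has law `β`. -/
def infoGain (M : Model S A H d) (β : Measure (Param H d)) (π : RandPolicy S A H) : ℝ≥0∞ :=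
  InformationTheory.klDiv (β ⊗ₘ (randEpisode M π)) (β.prod ((randEpisode M π) ∘ₘ β))

/-- The score `Δ(π)² / (I(π) + η)`.  For `η = 0`, division in `ℝ≥0∞` gives the conventions
`x / 0 = ∞` for `x > 0` and `0 / 0 = 0`. -/
def score (M : Model S A H d) (πs : CtxPolicy (Param H d) S A H) (η : ℝ≥0)
    (β : Measure (Param H d)) (π : RandPolicy S A H) : ℝ≥0∞ :=
  ENNReal.ofReal (regret M πs β π ^ 2) / (infoGain M β π + η)

/-- The rule `alg` is regularised information-directed sampling `IDS_η` with target `w` over the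
feasible set `Pi` during the first `T` episodes: almost surely, it plays a minimiser of the score
over `Pi`. -/
def IsIDS (M : Model S A H d) (lam : ℝ) (D : Dataset S A H) (πs : CtxPolicy (Param H d) S A H)
    (Pi : Set (RandPolicy S A H)) (η : ℝ≥0) (T : ℕ) (alg : Algorithm S A H) : Prop :=
  ∀ t < T, ∀ᵐ ω ∂(histLaw M lam D alg t),
    playedPolicy alg t ω ∈ Pi ∧
      IsMinOn (score M πs η (posteriorAt M lam D alg t ω)) Pi (playedPolicy alg t ω)

/-- The regret `Δ_t(π_t)` of the played policy as a function of the history. -/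
def episodeRegret (M : Model S A H d) (lam : ℝ) (D : Dataset S A H)
    (πs : CtxPolicy (Param H d) S A H) (alg : Algorithm S A H) (t : ℕ) (ω : Hist S A H t) : ℝ :=
  regret M πs (posteriorAt M lam D alg t ω) (playedPolicy alg t ω)

/-- Bayesian regret over `T` online episodes conditional on the offline data. -/
def bayesRegret (M : Model S A H d) (lam : ℝ) (D : Dataset S A H)
    (πs : CtxPolicy (Param H d) S A H) (alg : Algorithm S A H) (T : ℕ) : ℝ :=
  ∑ t ∈ Finset.range T, ∫ ω, episodeRegret M lam D πs alg t ω ∂(histLaw M lam D alg t)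

/-! ### Coverage -/

/-- Smallest eigenvalue of a symmetric matrix. -/
def lambdaMin (B : Matrix (Fin d) (Fin d) ℝ) : ℝ := sInf (spectrum ℝ B)

/-- Largest eigenvalue of a symmetric matrix. -/
def lambdaMax (B : Matrix (Fin d) (Fin d) ℝ) : ℝ := sSup (spectrum ℝ B)

/-- Time-averaged online visitation covariance `T⁻¹ ∑_{t<T} E[φ_{t,h} φ_{t,h}ᵀ | D]`. -/
def visitCov (M : Model S A H d) (lam : ℝ) (D : Dataset S A H) (alg : Algorithm S A H) (T : ℕ)
    (h : Fin H) : Matrix (Fin d) (Fin d) ℝ :=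
  Matrix.of fun i j => (1 / (T : ℝ)) * ∑ t : Fin T,
    ∫ ω, featAt M (ω t) h i * featAt M (ω t) h j ∂(histLaw M lam D alg T)

/-- `C_{β,h}(N,T) = λ_max((Λ_{h,N}/n_h)^{-1/2} Σ̄_{h,T} (Λ_{h,N}/n_h)^{-1/2})`. -/
def stageCoverage (M : Model S A H d) (lam : ℝ) (D : Dataset S A H) (alg : Algorithm S A H)
    (T : ℕ) (h : Fin H) : ℝ :=
  lambdaMax ((CFC.sqrt ((D.n h : ℝ)⁻¹ • gram M lam D h))⁻¹ * visitCov M lam D alg T h *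
    (CFC.sqrt ((D.n h : ℝ)⁻¹ • gram M lam D h))⁻¹)

/-- `C†_β(N,T) = (N/H) ∑_h C_{β,h}(N,T) / n_h`. -/
def coverage (M : Model S A H d) (lam : ℝ) (D : Dataset S A H) (alg : Algorithm S A H)
    (T : ℕ) : ℝ :=
  (D.size : ℝ) / H * ∑ h, stageCoverage M lam D alg T h / D.n h

/-- `L_N(T) = (1/H) ∑_h log(1 + T / (d λ_min(Λ_{h,N})))`. -/
def avgLog (M : Model S A H d) (lam : ℝ) (D : Dataset S A H) (T : ℕ) : ℝ :=
  (1 / (H : ℝ)) * ∑ h, Real.log (1 + T / (d * lambdaMin (gram M lam D h)))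

end OffToOn

end

noncomputable section

namespace OffToOn

/-! ### Exponential tilts of measures and Gaussian densities up to constants. -/

section

section Tilted

variable {α β : Type*} [MeasurableSpace α] [MeasurableSpace β]

/-! The argument is an information-ratio argument: bound (regret)² by a constant times information
for Thompson sampling, transfer the bound to the minimiser of the ratio, and bound the total
information by a log-determinant.

Given data and history, the posterior is a product over stages of Gaussians whose precision Λ_h is
the Gram matrix of all offline and online features (`posteriorAt_ae_eq`). Transitions are known and
policies ignore observations, so the law of states and actions is the same under every parameter
(`lintegral_rollout_eraseObs`); only the Gaussian observations carry information. Hence the mutual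
information between w and an episode is exactly E ∑_h ½ log(1 + φ_hᵀ Λ_h⁻¹ φ_h)
(`infoGain_paramGaussian`).

Thompson sampling plays the policy of an independent posterior copy. Exchanging the two copies turns
its regret into the difference of the values of one policy, that of w, under w and under w'. As the
link is 1-Lipschitz, this is at most E ∑_h |⟨φ_h, w_h − w'_h⟩|. Here φ_h is correlated with w, so
Young's inequality in the dual norms of Λ_h⁻¹ and Λ_h separates the two factors; the expectation of
(w_h − w'_h)ᵀ Λ_h (w_h − w'_h) is 2d. Optimising Young's constant gives regret² ≤ 2Hd · E ∑_h φ_hᵀ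
Λ_h⁻¹ φ_h. Since λ ≥ 1, each term lies in [0,1], where x log 2 ≤ log(1 + x), so regret² ≤ (4Hd / log
2) · information (`exists_randClosure_regret_sq_le`). A minimiser of the ratio over a class
containing Thompson sampling satisfies the same inequality (`ae_episodeRegret_sq_le`).

By the matrix determinant lemma the expected gains add up to the expectation of ½ ∑_h log(det Λ_h /
det Λ_{h,N}) (`lintegral_potential`). AM-GM on eigenvalues bounds this by (Hd/2) L_N(T); the cruder
log(1 + x) ≤ x makes it linear in the visitation covariance and bounds its mean by (Hd/2) T C†/N.
Cauchy–Schwarz over the T episodes concludes, with constant (4Hd / log 2)(Hd/2) = 2(Hd)² / log 2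
under the root. -/

lemma tilted_add_const (μ : Measure α) (f : α → ℝ) (c : ℝ) :
    μ.tilted (fun x => f x + c) = μ.tilted f := by
  unfold Measure.tilted
  simp only [Real.exp_add, integral_mul_const]
  congr with x
  rw [mul_div_mul_right _ _ (Real.exp_pos c).ne']

lemma tilted_smul_measure (μ : Measure α) (f : α → ℝ) {c : ℝ≥0∞} (h0 : c ≠ 0) (ht : c ≠ ∞) :
    (c • μ).tilted f = μ.tilted f := by
  have hc : 0 < c.toReal := ENNReal.toReal_pos h0 ht
  unfold Measure.tilted
  rw [integral_smul_measure, withDensity_smul_measure, ← withDensity_smul' _ _ ht]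
  congr with x
  simp only [Pi.smul_apply, smul_eq_mul]
  rw [← ENNReal.ofReal_toReal ht, ← ENNReal.ofReal_mul hc.le, ENNReal.ofReal_toReal ht]
  congr 1
  field_simp

lemma map_tilted (μ : Measure α) (f : α → ℝ) (e : α ≃ᵐ β) :
    (μ.tilted f).map e = (μ.map e).tilted (f ∘ e.symm) := by
  ext s hs
  rw [Measure.map_apply e.measurable hs, tilted_apply' _ _ (e.measurable hs),
    tilted_apply' _ _ hs, e.measurableEmbedding.restrict_map, lintegral_map_equiv,
    integral_map_equiv]
  simp

lemma pi_tilted {ι : Type*} [Fintype ι] {X : ι → Type*} [∀ i, MeasurableSpace (X i)]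
    (μ : ∀ i, Measure (X i)) [∀ i, SigmaFinite (μ i)] [∀ i, NeZero (μ i)] (f : ∀ i, X i → ℝ)
    (hf : ∀ i, Integrable (fun x => Real.exp (f i x)) (μ i)) :
    Measure.pi (fun i => (μ i).tilted (f i)) = (Measure.pi μ).tilted (fun x => ∑ i, f i (x i)) := by
  have := fun i => isProbabilityMeasure_tilted (hf i)
  refine Measure.pi_eq fun s hs => ?_
  rw [tilted_apply_eq_ofReal_integral' _ (MeasurableSet.univ_pi hs), Measure.restrict_pi_pi]
  simp only [tilted_apply_eq_ofReal_integral' _ (hs _), Real.exp_sum]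
  rw [integral_fintype_prod_eq_prod (fun i x => Real.exp (f i x)), ← ENNReal.ofReal_prod_of_nonneg]
  · congr 1
    rw [integral_div, integral_fintype_prod_eq_prod (fun i x => Real.exp (f i x)),
      ← Finset.prod_div_distrib]
    simp only [integral_div]
  · intro i _
    exact integral_nonneg fun x => by positivity

end Tilted

section GaussianDensity

variable {ι : Type*} [Fintype ι] [DecidableEq ι]

lemma gaussianReal_zero_one_eq_tilted :
    gaussianReal 0 1 = (volume : Measure ℝ).tilted (fun x => -(1 / 2) * (x * x)) := by
  rw [gaussianReal_of_var_ne_zero _ one_ne_zero, Measure.tilted]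
  congr with x
  rw [gaussianPDF, gaussianPDFReal]
  have h := integral_gaussian (1 / 2)
  have h2 : ∫ x : ℝ, Real.exp (-(1 / 2) * (x * x)) = √(2 * Real.pi) := by
    rw [← show Real.pi / (1 / 2) = 2 * Real.pi by ring, ← h]
    simp [pow_two]
  rw [h2]
  congr 1
  simp only [sub_zero, NNReal.coe_one, mul_one]
  rw [inv_mul_eq_div]
  congr 2
  ring

lemma stdGaussian_eq_tilted :
    stdGaussian (EuclideanSpace ℝ ι) =
      (volume : Measure (EuclideanSpace ℝ ι)).tilted (fun x => -(1 / 2) * (x.ofLp ⬝ᵥ x.ofLp)) := by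
  have hint : Integrable (fun x : ℝ => Real.exp (-(1 / 2) * (x * x))) := by
    have := integrable_exp_neg_mul_sq (b := 1 / 2) (by norm_num)
    simpa [pow_two] using this
  rw [← map_pi_eq_stdGaussian, gaussianReal_zero_one_eq_tilted,
    pi_tilted (fun _ : ι => (volume : Measure ℝ)) (fun _ x => -(1 / 2) * (x * x)) fun _ => hint]
  have h := map_tilted (Measure.pi fun _ : ι => (volume : Measure ℝ))
    (fun x => ∑ i, -(1 / 2) * (x i * x i)) (MeasurableEquiv.toLp 2 (ι → ℝ))
  rw [show (⇑(MeasurableEquiv.toLp 2 (ι → ℝ))) = WithLp.toLp 2 from rfl, ← volume_pi,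
    (PiLp.volume_preserving_toLp ι).map_eq] at h
  rw [← volume_pi, h]
  congr with x
  simp [dotProduct, Finset.mul_sum]

/-- The log-density, up to a constant, of the Gaussian with precision matrix `Λ` and mean
`Λ⁻¹ b`. -/
def quadExp (Λ : Matrix ι ι ℝ) (b : EuclideanSpace ℝ ι) (w : EuclideanSpace ℝ ι) : ℝ :=
  -(1 / 2) * (w.ofLp ⬝ᵥ Λ *ᵥ w.ofLp) + b.ofLp ⬝ᵥ w.ofLp

/-- The Gaussian with precision matrix `Λ` and mean `Λ⁻¹ b`. -/
def precGaussian (Λ : Matrix ι ι ℝ) (b : EuclideanSpace ℝ ι) : Measure (EuclideanSpace ℝ ι) :=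
  multivariateGaussian (WithLp.toLp 2 (Λ⁻¹ *ᵥ b.ofLp)) Λ⁻¹

instance (Λ : Matrix ι ι ℝ) (b : EuclideanSpace ℝ ι) : IsProbabilityMeasure (precGaussian Λ b) := by
  unfold precGaussian
  infer_instance

/-- The measure is the image of the standard Gaussian under x ↦ μ + Λ^{-1/2} x, which multiplies
Lebesgue measure by a constant. A tilt ignores constant factors of the measure and additive
constants of the exponent, so completing the square suffices and no determinant has to be computed.
-/
lemma precGaussian_eq_tilted {Λ : Matrix ι ι ℝ} (hΛ : Λ.PosDef) (b : EuclideanSpace ℝ ι) :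
    precGaussian Λ b = (volume : Measure (EuclideanSpace ℝ ι)).tilted (quadExp Λ b) := by
  set B : Matrix ι ι ℝ := CFC.sqrt Λ⁻¹ with hB
  have hBB : B * B = Λ⁻¹ := CFC.sqrt_mul_sqrt_self _ hΛ.inv.posSemidef.nonneg
  have hBH : Bᵀ = B := by
    have := (CFC.sqrt_nonneg Λ⁻¹).isSelfAdjoint
    simpa [IsSelfAdjoint, star_eq_conjTranspose] using this
  have hdetΛ : IsUnit Λ.det := hΛ.det_pos.ne'.isUnit
  have hdet : IsUnit B.det := by
    have h1 : B.det * B.det = Λ⁻¹.det := by rw [← det_mul, hBB]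
    have h2 : Λ⁻¹.det ≠ 0 := hΛ.inv.det_pos.ne'
    refine isUnit_iff_ne_zero.2 fun h => h2 ?_
    rw [← h1, h, zero_mul]
  have hBinv : B⁻¹ * B⁻¹ = Λ := by
    rw [← Matrix.mul_inv_rev, hBB, nonsing_inv_nonsing_inv _ hdetΛ]
  set μ : EuclideanSpace ℝ ι := WithLp.toLp 2 (Λ⁻¹ *ᵥ b.ofLp) with hμ
  let e : EuclideanSpace ℝ ι ≃ᵐ EuclideanSpace ℝ ι :=
    { toFun := fun x => μ + toEuclideanCLM (𝕜 := ℝ) B x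
      invFun := fun x => toEuclideanCLM (𝕜 := ℝ) B⁻¹ (x - μ)
      left_inv := fun x => by
        simp only [add_sub_cancel_left]
        rw [← mul_apply_eq_comp, ← map_mul, nonsing_inv_mul _ hdet]
        simp
      right_inv := fun x => by
        simp only
        rw [← mul_apply_eq_comp, ← map_mul, mul_nonsing_inv _ hdet]
        simp
      measurable_toFun := by simp only [Equiv.coe_fn_mk]; fun_prop
      measurable_invFun := by simp only [Equiv.coe_fn_symm_mk]; fun_prop }
  have hvol : ∃ c : ℝ≥0∞, c ≠ 0 ∧ c ≠ ∞ ∧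
      (volume : Measure (EuclideanSpace ℝ ι)).map e = c • volume := by
    let L : EuclideanSpace ℝ ι →ₗ[ℝ] EuclideanSpace ℝ ι := (toEuclideanCLM (𝕜 := ℝ) B).toLinearMap
    have hL : LinearMap.det L ≠ 0 := by
      have hu : IsUnit L := by
        refine ⟨⟨L, (toEuclideanCLM (𝕜 := ℝ) B⁻¹).toLinearMap, ?_, ?_⟩, rfl⟩
        · ext x : 1
          change (toEuclideanCLM (𝕜 := ℝ) B * toEuclideanCLM (𝕜 := ℝ) B⁻¹) x = x
          rw [← map_mul, mul_nonsing_inv _ hdet]; simp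
        · ext x : 1
          change (toEuclideanCLM (𝕜 := ℝ) B⁻¹ * toEuclideanCLM (𝕜 := ℝ) B) x = x
          rw [← map_mul, nonsing_inv_mul _ hdet]; simp
      exact (hu.map (LinearMap.det)).ne_zero
    have h1 := Measure.map_linearMap_addHaar_eq_smul_addHaar
      (volume : Measure (EuclideanSpace ℝ ι)) hL
    refine ⟨ENNReal.ofReal |(LinearMap.det L)⁻¹|, ?_, ENNReal.ofReal_ne_top, ?_⟩
    · simpa using hL
    · have h2 : (⇑e) = (fun x => μ + x) ∘ L := rfl
      rw [h2, ← Measure.map_map (measurable_const_add μ)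
        (toEuclideanCLM (𝕜 := ℝ) B).continuous.measurable (f := L), h1, Measure.map_smul,
        map_add_left_eq_self]
  obtain ⟨c, hc0, hct, hc⟩ := hvol
  have : precGaussian Λ b = (stdGaussian (EuclideanSpace ℝ ι)).map e := rfl
  rw [this, stdGaussian_eq_tilted, map_tilted, hc, tilted_smul_measure _ _ hc0 hct]
  have hq : ((fun x : EuclideanSpace ℝ ι => -(1 / 2) * (x.ofLp ⬝ᵥ x.ofLp)) ∘ e.symm) =
      fun w => quadExp Λ b w + -(1 / 2) * (μ.ofLp ⬝ᵥ Λ *ᵥ μ.ofLp) := by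
    ext w
    have hBinvT : (B⁻¹)ᵀ = B⁻¹ := by rw [transpose_nonsing_inv, hBH]
    have hΛT : Λᵀ = Λ := by simpa using hΛ.isHermitian.eq
    have h1 : (e.symm w).ofLp = B⁻¹ *ᵥ (w.ofLp - μ.ofLp) := by
      change (toEuclideanCLM (𝕜 := ℝ) B⁻¹ (w - μ)).ofLp = _
      simp [mulVec_sub]
    have h2 : ∀ u : ι → ℝ, (B⁻¹ *ᵥ u) ⬝ᵥ (B⁻¹ *ᵥ u) = u ⬝ᵥ Λ *ᵥ u := by
      intro u
      rw [dotProduct_mulVec, ← mulVec_transpose, hBinvT, mulVec_mulVec, hBinv, dotProduct_comm]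
    have h3 : Λ *ᵥ μ.ofLp = b.ofLp := by
      simp [hμ, mulVec_mulVec, mul_nonsing_inv _ hdetΛ]
    have h4 : μ.ofLp ⬝ᵥ Λ *ᵥ w.ofLp = b.ofLp ⬝ᵥ w.ofLp := by
      rw [dotProduct_mulVec, ← mulVec_transpose, hΛT, h3]
    rw [Function.comp_apply, h1, h2]
    simp only [quadExp, mulVec_sub, sub_dotProduct, dotProduct_sub,
      h3, h4, dotProduct_comm w.ofLp b.ofLp]
    ring
  rw [hq, tilted_add_const]

lemma integrable_exp_quadExp {Λ : Matrix ι ι ℝ} (hΛ : Λ.PosDef) (b : EuclideanSpace ℝ ι) :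
    Integrable (fun w => Real.exp (quadExp Λ b w)) (volume : Measure (EuclideanSpace ℝ ι)) := by
  by_contra h
  -- A tilt by a non-integrable exponential is the zero measure by convention, whereas here the tilt
  -- is a probability measure.
  have h1 := tilted_of_not_integrable h
  rw [← precGaussian_eq_tilted hΛ b] at h1
  exact IsProbabilityMeasure.ne_zero _ h1

end GaussianDensity

end

/-! ### One-dimensional Gaussian integrals and quadratic forms. -/

section

section RealGaussian

/-- The likelihood ratio of a single observation. It is the building block for referring all
trajectory laws to the parameter 0. -/
lemma lintegral_gaussianReal_one (θ : ℝ) {F : ℝ → ℝ≥0∞} (hF : Measurable F) :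
    ∫⁻ y, F y ∂gaussianReal θ 1 =
      ∫⁻ y, F y * ENNReal.ofReal (Real.exp (y * θ - θ ^ 2 / 2)) ∂gaussianReal 0 1 := by
  rw [gaussianReal_of_var_ne_zero _ one_ne_zero, gaussianReal_of_var_ne_zero _ one_ne_zero,
    lintegral_withDensity_eq_lintegral_mul _ (measurable_gaussianPDF _ _) hF,
    lintegral_withDensity_eq_lintegral_mul _ (measurable_gaussianPDF _ _) (by fun_prop)]
  refine lintegral_congr fun y => ?_
  simp only [Pi.mul_apply, gaussianPDF]
  rw [mul_left_comm, ← ENNReal.ofReal_mul (gaussianPDFReal_nonneg _ _ _), mul_comm]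
  congr 2
  simp only [gaussianPDFReal, mul_assoc]
  rw [← Real.exp_add]
  congr 2
  simp only [NNReal.coe_one]
  ring

lemma integrable_exp_quadratic {μ : Measure ℝ} [IsFiniteMeasure μ] (y : ℝ) :
    Integrable (fun s => Real.exp (y * s - s ^ 2 / 2)) μ := by
  refine Integrable.of_bound (C := Real.exp (y ^ 2 / 2)) (by fun_prop)
    (Filter.Eventually.of_forall fun s => ?_)
  rw [Real.norm_eq_abs, Real.abs_exp, Real.exp_le_exp]
  nlinarith [sq_nonneg (y - s)]

/-- The evidence of an observation y with unit noise when its mean has law N(m, v): marginally y is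
N(m, 1 + v), and the right side is that density divided by the N(0, 1) density. -/
lemma integral_exp_quadratic_gaussianReal (m y : ℝ) (v : ℝ≥0) :
    ∫ s, Real.exp (y * s - s ^ 2 / 2) ∂gaussianReal m v =
      Real.exp (y ^ 2 / 2 - (y - m) ^ 2 / (2 * (1 + v)) - Real.log (1 + v) / 2) := by
  have h1v : (0 : ℝ) < 1 + v := by positivity
  rcases eq_or_ne v 0 with rfl | hv
  · rw [gaussianReal_zero_var, integral_dirac]
    congr 1
    simp only [NNReal.coe_zero, add_zero, Real.log_one]
    ring
  rw [integral_gaussianReal_eq_integral_smul hv]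
  have hv0 : (0 : ℝ) < v := by positivity
  -- Variance v' and mean m' of the posterior of s given y; completing the square makes the
  -- integrand the evidence times this posterior density.
  set v' : ℝ≥0 := v / (1 + v) with hv'
  have hv'0 : v' ≠ 0 := by positivity
  have hv'c : (v' : ℝ) = v / (1 + v) := by simp [hv']
  set m' : ℝ := (m + v * y) / (1 + v) with hm'
  have key : ∀ s, gaussianPDFReal m v s • Real.exp (y * s - s ^ 2 / 2) =
      Real.exp (y ^ 2 / 2 - (y - m) ^ 2 / (2 * (1 + v)) - Real.log (1 + v) / 2) *
        gaussianPDFReal m' v' s := by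
    intro s
    have hsq : √(2 * Real.pi * v) = √(1 + v) * √(2 * Real.pi * v') := by
      rw [← Real.sqrt_mul h1v.le, hv'c]
      congr 1
      field_simp
    have hlog : Real.exp (-(Real.log (1 + v) / 2)) = (√(1 + v))⁻¹ := by
      rw [Real.exp_neg, ← Real.log_sqrt h1v.le, Real.exp_log (Real.sqrt_pos.2 h1v)]
    simp only [gaussianPDFReal, smul_eq_mul]
    rw [sub_eq_add_neg _ (Real.log _ / 2), Real.exp_add, hlog, hsq, mul_inv]
    have hexp : Real.exp (-(s - m) ^ 2 / (2 * v)) * Real.exp (y * s - s ^ 2 / 2) =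
        Real.exp (y ^ 2 / 2 - (y - m) ^ 2 / (2 * (1 + v))) *
          Real.exp (-(s - m') ^ 2 / (2 * v')) := by
      rw [← Real.exp_add, ← Real.exp_add, hv'c, hm']
      congr 1
      field_simp
      ring
    linear_combination (√(1 + v))⁻¹ * (√(2 * Real.pi * v'))⁻¹ * hexp
  simp only [key]
  rw [integral_const_mul, integral_gaussianPDFReal_eq_one _ hv'0, mul_one]

lemma lintegral_sub_sq_gaussianReal_one (θ m : ℝ) :
    ∫⁻ y, ENNReal.ofReal ((y - m) ^ 2) ∂gaussianReal θ 1 = ENNReal.ofReal (1 + (θ - m) ^ 2) := by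
  have h2 := (memLp_id_gaussianReal (μ := θ) (v := 1) 2)
  have hi2 : Integrable (fun y => y ^ 2) (gaussianReal θ 1) := h2.integrable_sq
  have hi1 : Integrable (fun y => y) (gaussianReal θ 1) := h2.integrable (by simp)
  have hv := variance_eq_sub h2
  rw [variance_id_gaussianReal] at hv
  simp only [Pi.pow_apply, id_eq, integral_id_gaussianReal, NNReal.coe_one] at hv
  have hint : Integrable (fun y => (y - m) ^ 2) (gaussianReal θ 1) := by
    have : (fun y : ℝ => (y - m) ^ 2) = fun y => y ^ 2 - 2 * m * y + m ^ 2 := by ext; ring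
    rw [this]
    exact (hi2.sub (hi1.const_mul _)).add (integrable_const _)
  rw [← ofReal_integral_eq_lintegral_ofReal hint (Filter.Eventually.of_forall fun y => sq_nonneg _)]
  congr 1
  have : (fun y : ℝ => (y - m) ^ 2) = fun y => y ^ 2 - 2 * m * y + m ^ 2 := by ext; ring
  have s1 := integral_add (hi2.sub (hi1.const_mul (2 * m))) (integrable_const (m ^ 2))
  simp only [Pi.sub_apply] at s1
  rw [this, s1, integral_sub hi2 (hi1.const_mul _), integral_const_mul, integral_id_gaussianReal]
  simp only [integral_const, probReal_univ, one_smul]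
  linarith

end RealGaussian

section Quadratic

variable {ι : Type*} [Fintype ι]

/-- The quadratic form `xᵀ S x`. -/
def quadForm (S : Matrix ι ι ℝ) (x : EuclideanSpace ℝ ι) : ℝ :=
  x.ofLp ⬝ᵥ S *ᵥ x.ofLp

lemma quadForm_eq_sum (S : Matrix ι ι ℝ) (x : EuclideanSpace ℝ ι) :
    quadForm S x = ∑ i, ∑ j, S i j * (x i * x j) := by
  simp only [quadForm, dotProduct, mulVec, Finset.mul_sum]
  exact Finset.sum_congr rfl fun i _ => Finset.sum_congr rfl fun j _ => by ring

lemma continuous_quadForm (S : Matrix ι ι ℝ) : Continuous (quadForm S) := by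
  simp only [funext (quadForm_eq_sum S)]
  fun_prop

@[fun_prop]
lemma measurable_quadForm (S : Matrix ι ι ℝ) : Measurable (quadForm S) :=
  (continuous_quadForm S).measurable

lemma quadForm_nonneg {S : Matrix ι ι ℝ} (hS : S.PosSemidef) (x : EuclideanSpace ℝ ι) :
    0 ≤ quadForm S x := by
  have := hS.dotProduct_mulVec_nonneg x.ofLp
  simpa [quadForm] using this

variable [DecidableEq ι]

lemma map_inner_multivariateGaussian (μ : EuclideanSpace ℝ ι) {S : Matrix ι ι ℝ}
    (hS : S.PosSemidef) (x : EuclideanSpace ℝ ι) :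
    (multivariateGaussian μ S).map (fun w => inner ℝ x w) =
      gaussianReal (inner ℝ x μ) (quadForm S x).toNNReal := by
  have h := IsGaussian.map_eq_gaussianReal (μ := multivariateGaussian μ S) (innerSL ℝ x)
  have h1 : Var[innerSL ℝ x; multivariateGaussian μ S] = quadForm S x := by
    rw [quadForm, ← covarianceBilin_multivariateGaussian (μ := μ) hS,
      covarianceBilin_self IsGaussian.memLp_two_id]
    rfl
  have h2 : (multivariateGaussian μ S)[innerSL ℝ x] = inner ℝ x μ := by
    rw [IsGaussian.integral_dual, integral_id_multivariateGaussian]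
    rfl
  rw [h1, h2] at h
  exact h

/-- The difference of two independent copies is centred with covariance 2Λ⁻¹, so the expectation is
tr(Λ · 2Λ⁻¹). -/
lemma lintegral_quadForm_sub_precGaussian {Λ : Matrix ι ι ℝ} (hΛ : Λ.PosDef)
    (b : EuclideanSpace ℝ ι) :
    ∫⁻ p, ENNReal.ofReal (quadForm Λ (p.1 - p.2)) ∂((precGaussian Λ b).prod (precGaussian Λ b)) =
      ENNReal.ofReal (2 * Fintype.card ι) := by
  set γ := precGaussian Λ b with hγ
  set μ : EuclideanSpace ℝ ι := WithLp.toLp 2 (Λ⁻¹ *ᵥ b.ofLp)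
  have hγ' : γ = multivariateGaussian μ Λ⁻¹ := rfl
  have hG : IsGaussian γ := by rw [hγ']; infer_instance
  have hm2 : ∀ i, MemLp (fun w : EuclideanSpace ℝ ι => w i) 2 γ := fun i => by
    have := (EuclideanSpace.proj (𝕜 := ℝ) i : StrongDual ℝ (EuclideanSpace ℝ ι)).comp_memLp'
      (IsGaussian.memLp_two_id (μ := γ))
    exact this
  have hi1 : ∀ i, Integrable (fun w : EuclideanSpace ℝ ι => w i) γ :=
    fun i => (hm2 i).integrable (by simp)
  have hi2 : ∀ i j, Integrable (fun w : EuclideanSpace ℝ ι => w i * w j) γ :=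
    fun i j => (hm2 i).integrable_mul (hm2 j)
  have hE1 : ∀ i, ∫ w, w i ∂γ = μ i := fun i => by
    have := IsGaussian.integral_dual (μ := γ)
      (EuclideanSpace.proj (𝕜 := ℝ) i : StrongDual ℝ (EuclideanSpace ℝ ι))
    rw [hγ', integral_id_multivariateGaussian] at this
    exact this
  have hE2 : ∀ i j, ∫ w, w i * w j ∂γ = Λ⁻¹ i j + μ i * μ j := fun i j => by
    have h := covariance_eval_multivariateGaussian (μ := μ) hΛ.inv.posSemidef i j
    rw [← hγ', covariance_eq_sub (hm2 i) (hm2 j), hE1, hE1] at h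
    simp only [Pi.mul_apply] at h
    linarith
  have hpair : ∀ i j, Integrable (fun p : EuclideanSpace ℝ ι × EuclideanSpace ℝ ι =>
      (p.1 - p.2) i * (p.1 - p.2) j) (γ.prod γ) ∧
      ∫ p, (p.1 - p.2) i * (p.1 - p.2) j ∂(γ.prod γ) = 2 * Λ⁻¹ i j := by
    intro i j
    have e : (fun p : EuclideanSpace ℝ ι × EuclideanSpace ℝ ι =>
      (p.1 - p.2) i * (p.1 - p.2) j) = fun p => (p.1 i * p.1 j + p.2 i * p.2 j) -
        (p.1 i * p.2 j + p.1 j * p.2 i) := by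
      ext p; simp only [PiLp.sub_apply]; ring
    have a1 := (hi2 i j).comp_fst γ
    have a2 := (hi2 i j).comp_snd γ
    have a3 := (hi1 i).mul_prod (hi1 j)
    have a4 := (hi1 j).mul_prod (hi1 i)
    rw [e]
    refine ⟨(a1.add a2).sub (a3.add a4), ?_⟩
    have s1 := integral_sub (a1.add a2) (a3.add a4)
    simp only [Pi.add_apply] at s1
    rw [s1, integral_add a1 a2, integral_add a3 a4,
      integral_prod_mul (μ := γ) (ν := γ) (fun w : EuclideanSpace ℝ ι => w i)
        (fun w : EuclideanSpace ℝ ι => w j),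
      integral_prod_mul (μ := γ) (ν := γ) (fun w : EuclideanSpace ℝ ι => w j)
        (fun w : EuclideanSpace ℝ ι => w i),
      integral_fun_fst (μ := γ) (ν := γ) (fun w : EuclideanSpace ℝ ι => w i * w j),
      integral_fun_snd (μ := γ) (ν := γ) (fun w : EuclideanSpace ℝ ι => w i * w j)]
    simp only [hE1, hE2, probReal_univ, one_smul]
    ring
  simp only [quadForm_eq_sum]
  have hint : ∀ i j, Integrable (fun p : EuclideanSpace ℝ ι × EuclideanSpace ℝ ι =>
      Λ i j * ((p.1 - p.2) i * (p.1 - p.2) j)) (γ.prod γ) :=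
    fun i j => (hpair i j).1.const_mul _
  rw [← ofReal_integral_eq_lintegral_ofReal]
  · congr 1
    rw [integral_finsetSum _ fun i _ => integrable_finsetSum _ fun j _ => hint i j]
    simp only [integral_finsetSum _ fun j _ => hint _ j, integral_const_mul, (hpair _ _).2]
    have htr : (Λ * Λ⁻¹).trace = Fintype.card ι := by
      rw [mul_nonsing_inv _ hΛ.det_pos.ne'.isUnit, trace_one]
    have hsym : ∀ i j, Λ⁻¹ i j = Λ⁻¹ j i := fun i j => by
      have := hΛ.inv.isHermitian.apply j i
      simpa using this
    rw [← htr]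
    simp only [trace, diag_apply, mul_apply, Finset.mul_sum]
    exact Finset.sum_congr rfl fun i _ => Finset.sum_congr rfl fun j _ => by rw [hsym i j]; ring
  · exact integrable_finsetSum _ fun i _ => integrable_finsetSum _ fun j _ => hint i j
  · exact Filter.Eventually.of_forall fun p => by
      simpa only [quadForm_eq_sum, Pi.zero_apply] using quadForm_nonneg hΛ.posSemidef (p.1 - p.2)

/-- Positivity of the form Λ at v ± c Λ⁻¹x. This additive form of Cauchy–Schwarz lets expectations
of the two terms be taken separately, even if x and v are dependent, before c is optimised. -/
lemma abs_inner_le_quadForm {Λ : Matrix ι ι ℝ} (hΛ : Λ.PosDef) (x v : EuclideanSpace ℝ ι) {c : ℝ}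
    (hc : 0 < c) :
    |inner ℝ x v| ≤ c / 2 * quadForm Λ⁻¹ x + 1 / (2 * c) * quadForm Λ v := by
  have hu : IsUnit Λ.det := hΛ.det_pos.ne'.isUnit
  have hT : (Λ⁻¹)ᵀ = Λ⁻¹ := by simpa using hΛ.inv.isHermitian.eq
  have key : ∀ a : ℝ, 0 ≤ a ^ 2 * quadForm Λ⁻¹ x + 2 * a * inner ℝ x v + quadForm Λ v := by
    intro a
    have h := quadForm_nonneg hΛ.posSemidef (WithLp.toLp 2 (a • (Λ⁻¹ *ᵥ x.ofLp) + v.ofLp))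
    have e : quadForm Λ (WithLp.toLp 2 (a • (Λ⁻¹ *ᵥ x.ofLp) + v.ofLp)) =
        a ^ 2 * quadForm Λ⁻¹ x + 2 * a * inner ℝ x v + quadForm Λ v := by
      have h1 : (Λ⁻¹ *ᵥ x.ofLp) ⬝ᵥ (Λ *ᵥ v.ofLp) = x.ofLp ⬝ᵥ v.ofLp := by
        rw [← hT, mulVec_transpose, ← dotProduct_mulVec, mulVec_mulVec, nonsing_inv_mul _ hu,
          one_mulVec]
      have h2 : inner ℝ x v = x.ofLp ⬝ᵥ v.ofLp := by
        rw [EuclideanSpace.inner_eq_star_dotProduct, dotProduct_comm]; simp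
      simp only [quadForm, mulVec_add, mulVec_smul, mulVec_mulVec, mul_nonsing_inv _ hu,
        one_mulVec, add_dotProduct, dotProduct_add, smul_dotProduct, dotProduct_smul, smul_eq_mul,
        h1, h2]
      rw [dotProduct_comm v.ofLp x.ofLp, dotProduct_comm (Λ⁻¹ *ᵥ x.ofLp) x.ofLp]
      ring
    linarith
  have k1 := key c
  have k2 := key (-c)
  have hq : c / 2 * quadForm Λ⁻¹ x + 1 / (2 * c) * quadForm Λ v =
      (c ^ 2 * quadForm Λ⁻¹ x + quadForm Λ v) / (2 * c) := by field_simp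
  rw [hq, le_div_iff₀ (by positivity), abs_eq_max_neg, max_mul_of_nonneg _ _ (by positivity)]
  exact max_le (by nlinarith) (by nlinarith)

end Quadratic

end

/-! ### Trajectory laws: independence of states and actions from the parameter, and change of
measure. -/

section

variable {S A Z Z' : Type*} [MeasurableSpace S] [MeasurableSpace A] [MeasurableSpace Z]
  [MeasurableSpace Z'] {H d : ℕ}

lemma obsKernel_apply (M : Model S A H d) (h : Fin H) (w : Param H d) (x : S × A) :
    obsKernel M h (w, x) = gaussianReal (inner ℝ (M.feat x) (w h)) 1 := by
  unfold obsKernel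
  rw [Kernel.map_apply _ (by fun_prop), Kernel.prod_apply, Kernel.deterministic_apply,
    Kernel.const_apply, Measure.dirac_prod, Measure.map_map (by fun_prop) (by fun_prop)]
  have := gaussianReal_map_const_add (μ := 0) (v := 1) (inner ℝ (M.feat x) (w h))
  simpa [Function.comp_def] using this

attribute [fun_prop] measurable_extend

section Extend

variable (k : ℕ) (τ : Traj S A k) (a : A) (y : ℝ) (s : S)

@[simp] lemma extend_fst_castSucc (j : Fin k) :
    (extend k (τ, (a, (y, s)))).1 j.castSucc = τ.1 j := by
  simp [extend]

@[simp] lemma extend_fst_last : (extend k (τ, (a, (y, s)))).1 (Fin.last k) = (τ.2, a, y) := by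
  simp [extend]

end Extend

lemma lintegral_rollout_succ (M : Model S A H d) (π : CtxPolicy Z S A H) (k : ℕ) (hk : k + 1 ≤ H)
    (x : (Param H d × Z) × S) {F : Traj S A (k + 1) → ℝ≥0∞} (hF : Measurable F) :
    ∫⁻ τ, F τ ∂(rollout M π (k + 1) hk x) =
      ∫⁻ τ, ∫⁻ a, ∫⁻ y, ∫⁻ s, F (extend k (τ, (a, (y, s))))
        ∂(M.trans ⟨k, hk⟩ (τ.2, a)) ∂(gaussianReal (inner ℝ (M.feat (τ.2, a)) (x.1.1 ⟨k, hk⟩)) 1)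
        ∂(π.act ⟨k, hk⟩ (x.1.2, τ.2)) ∂(rollout M π k (Nat.le_of_succ_le hk) x) := by
  have hFe : Measurable fun x => F (extend k x) := hF.comp (measurable_extend k)
  conv_lhs => unfold rollout
  rw [Kernel.map_apply _ (measurable_extend k), lintegral_map hF (measurable_extend k),
    Kernel.lintegral_compProd _ _ _ hFe]
  refine lintegral_congr fun τ => ?_
  unfold stageKernel
  rw [Kernel.lintegral_compProd _ _ _ (by fun_prop), Kernel.comap_apply]
  refine lintegral_congr fun a => ?_
  rw [Kernel.prod_apply, Kernel.comap_apply, Kernel.comap_apply, obsKernel_apply,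
    lintegral_prod _ (by fun_prop)]

lemma lintegral_rollout_zero (M : Model S A H d) (π : CtxPolicy Z S A H) (hk : 0 ≤ H)
    (x : (Param H d × Z) × S) {F : Traj S A 0 → ℝ≥0∞} (hF : Measurable F) :
    ∫⁻ τ, F τ ∂(rollout M π 0 hk x) = F (Fin.elim0, x.2) := by
  unfold rollout
  rw [Kernel.deterministic_apply, lintegral_dirac' _ hF]

/-- The law of a rollout depends on the context only through the policy it selects. -/
lemma rollout_comap (M : Model S A H d) (π : CtxPolicy Z S A H) (f : Z' → Z) (hf : Measurable f)
    (k : ℕ) (hk : k ≤ H) (w : Param H d) (z : Z') (s : S) :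
    rollout M (π.comap f hf) k hk ((w, z), s) = rollout M π k hk ((w, f z), s) := by
  induction k with
  | zero =>
    refine Measure.ext_of_lintegral _ fun F hF => ?_
    rw [lintegral_rollout_zero _ _ _ _ hF, lintegral_rollout_zero _ _ _ _ hF]
  | succ k ih =>
    refine Measure.ext_of_lintegral _ fun F hF => ?_
    rw [lintegral_rollout_succ _ _ _ _ _ hF, lintegral_rollout_succ _ _ _ _ _ hF, ih]
    rfl

/-- The trajectory without its observations. -/
def eraseObs {k : ℕ} (τ : Traj S A k) : (Fin k → S × A) × S :=
  (fun j => ((τ.1 j).1, (τ.1 j).2.1), τ.2)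

@[fun_prop]
lemma measurable_eraseObs {k : ℕ} : Measurable (eraseObs : Traj S A k → _) := by
  unfold eraseObs
  fun_prop

lemma eraseObs_extend (k : ℕ) (τ : Traj S A k) (a : A) (y : ℝ) (s : S) :
    eraseObs (extend k (τ, (a, (y, s)))) =
      (Fin.snoc (α := fun _ => S × A) (eraseObs τ).1 ((eraseObs τ).2, a), s) := by
  refine Prod.ext (funext fun j => ?_) rfl
  induction j using Fin.lastCases with
  | last => simp [eraseObs]
  | cast j => simp [eraseObs]

/-- The law of states and actions does not depend on the parameter. -/
lemma lintegral_rollout_eraseObs (M : Model S A H d) (π : CtxPolicy Z S A H) (k : ℕ) (hk : k ≤ H)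
    (w w' : Param H d) (z : Z) (s : S) {F : (Fin k → S × A) × S → ℝ≥0∞} (hF : Measurable F) :
    ∫⁻ τ, F (eraseObs τ) ∂(rollout M π k hk ((w, z), s)) =
      ∫⁻ τ, F (eraseObs τ) ∂(rollout M π k hk ((w', z), s)) := by
  induction k with
  | zero =>
    rw [lintegral_rollout_zero _ _ _ _ (by fun_prop), lintegral_rollout_zero _ _ _ _ (by fun_prop)]
  | succ k ih =>
    have hm : Measurable fun p : (((Fin k → S × A) × S) × A) × S =>
        F (Fin.snoc (α := fun _ => S × A) p.1.1.1 (p.1.1.2, p.1.2), p.2) := by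
      refine hF.comp (Measurable.prodMk ?_ measurable_snd)
      exact (measurable_snoc (X := S × A) k).comp
        (g := fun x : (Fin k → S × A) × (S × A) => Fin.snoc (α := fun _ => S × A) x.1 x.2)
        (f := fun p : (((Fin k → S × A) × S) × A) × S => (p.1.1.1, (p.1.1.2, p.1.2)))
        (by fun_prop)
    let F₂ : ((Fin k → S × A) × S) × A → ℝ≥0∞ := fun q =>
      ∫⁻ s', F (Fin.snoc (α := fun _ => S × A) q.1.1 (q.1.2, q.2), s')
        ∂(M.trans ⟨k, hk⟩ (q.1.2, q.2))
    have hF₂ : Measurable F₂ := by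
      exact hm.lintegral_kernel_prod_right' (κ := (M.trans ⟨k, hk⟩).comap
        (fun q : ((Fin k → S × A) × S) × A => (q.1.2, q.2)) (by fun_prop))
    let F₁ : (Fin k → S × A) × S → ℝ≥0∞ := fun p => ∫⁻ a, F₂ (p, a) ∂(π.act ⟨k, hk⟩ (z, p.2))
    have hF₁ : Measurable F₁ := by
      exact hF₂.lintegral_kernel_prod_right' (κ := (π.act ⟨k, hk⟩).comap
        (fun p : (Fin k → S × A) × S => (z, p.2)) (by fun_prop))
    -- Neither the policy nor the transition sees the observation, so integrating it out leaves a
    -- functional of the erased shorter trajectory that does not involve the parameter.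
    have step : ∀ u : Param H d,
        ∫⁻ τ, F (eraseObs τ) ∂(rollout M π (k + 1) hk ((u, z), s)) =
          ∫⁻ τ, F₁ (eraseObs τ) ∂(rollout M π k (Nat.le_of_succ_le hk) ((u, z), s)) := by
      intro u
      rw [lintegral_rollout_succ _ _ _ _ _ (by fun_prop)]
      refine lintegral_congr fun τ => lintegral_congr fun a => ?_
      simp only [eraseObs_extend, lintegral_const, measure_univ, mul_one]
      rfl
    rw [step w, step w', ih _ hF₁]

/-- Given its state and action, the observation at a stage is the linear predictor plus standard
Gaussian noise. -/
lemma lintegral_rollout_obs (M : Model S A H d) (π : CtxPolicy Z S A H) (k : ℕ) (hk : k ≤ H)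
    (w : Param H d) (z : Z) (s : S) (j : Fin k) {G : (S × A) × ℝ → ℝ≥0∞} (hG : Measurable G) :
    ∫⁻ τ, G (((τ.1 j).1, (τ.1 j).2.1), (τ.1 j).2.2) ∂(rollout M π k hk ((w, z), s)) =
      ∫⁻ τ, ∫⁻ y, G (((τ.1 j).1, (τ.1 j).2.1), y)
        ∂(gaussianReal (inner ℝ (M.feat ((τ.1 j).1, (τ.1 j).2.1)) (w (j.castLE hk))) 1)
        ∂(rollout M π k hk ((w, z), s)) := by
  have hm : ∀ h : Fin H, Measurable fun x : S × A =>
      ∫⁻ y, G (x, y) ∂(gaussianReal (inner ℝ (M.feat x) (w h)) 1) := by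
    intro h
    have := hG.lintegral_kernel_prod_right' (κ := (obsKernel M h).comap
      (fun x : S × A => (w, x)) (by fun_prop))
    simpa only [Kernel.comap_apply, obsKernel_apply] using this
  induction k with
  | zero => exact j.elim0
  | succ k ih =>
    have hl : Measurable fun τ : Traj S A (k + 1) =>
        G (((τ.1 j).1, (τ.1 j).2.1), (τ.1 j).2.2) := by fun_prop
    have hr : Measurable fun τ : Traj S A (k + 1) => ∫⁻ y, G (((τ.1 j).1, (τ.1 j).2.1), y)
        ∂(gaussianReal (inner ℝ (M.feat ((τ.1 j).1, (τ.1 j).2.1)) (w (j.castLE hk))) 1) :=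
      (hm (j.castLE hk)).comp (g := fun x : S × A =>
        ∫⁻ y, G (x, y) ∂(gaussianReal (inner ℝ (M.feat x) (w (j.castLE hk))) 1))
        (f := fun τ : Traj S A (k + 1) => ((τ.1 j).1, (τ.1 j).2.1)) (by fun_prop)
    rw [lintegral_rollout_succ _ _ _ _ _ hl, lintegral_rollout_succ _ _ _ _ _ hr]
    -- At the last stage the observation has just been drawn; for an earlier stage the later draws
    -- integrate to 1 and the induction hypothesis applies.
    induction j using Fin.lastCases with
    | last =>
      refine lintegral_congr fun τ => lintegral_congr fun a => ?_
      simp only [extend_fst_last, lintegral_const, measure_univ, mul_one]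
      rfl
    | cast j =>
      simp only [extend_fst_castSucc, lintegral_const, measure_univ, mul_one]
      exact ih (Nat.le_of_succ_le hk) j

/-- Log-density of one observation under the parameter `w` with respect to the parameter `0`. -/
def stageLogDensity (M : Model S A H d) (w : Param H d) (h : Fin H) (x : S × A × ℝ) : ℝ :=
  x.2.2 * inner ℝ (M.feat (x.1, x.2.1)) (w h) - (inner ℝ (M.feat (x.1, x.2.1)) (w h)) ^ 2 / 2

lemma measurable_stageLogDensity (M : Model S A H d) (h : Fin H) :
    Measurable fun p : Param H d × (S × A × ℝ) => stageLogDensity M p.1 h p.2 := by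
  have := M.measurable_feat
  unfold stageLogDensity
  fun_prop

/-- Log-density of a trajectory under the parameter `w` with respect to the parameter `0`. -/
def logDensity (M : Model S A H d) (w : Param H d) (τ : Traj S A H) : ℝ :=
  ∑ h, stageLogDensity M w h (τ.1 h)

@[fun_prop]
lemma measurable_logDensity (M : Model S A H d) :
    Measurable fun p : Param H d × Traj S A H => logDensity M p.1 p.2 := by
  unfold logDensity
  refine Finset.measurable_fun_sum _ fun h _ => ?_
  exact (measurable_stageLogDensity M h).comp
    (f := fun p : Param H d × Traj S A H => (p.1, p.2.1 h)) (by fun_prop)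

/-- Actions and transitions use the same kernels under w and under 0, so the likelihood ratio is the
product of the Gaussian ratios of the observations. -/
lemma lintegral_rollout_eq (M : Model S A H d) (π : CtxPolicy Z S A H) (k : ℕ) (hk : k ≤ H)
    (w : Param H d) (z : Z) (s : S) {F : Traj S A k → ℝ≥0∞} (hF : Measurable F) :
    ∫⁻ τ, F τ ∂(rollout M π k hk ((w, z), s)) =
      ∫⁻ τ, F τ * ENNReal.ofReal
          (Real.exp (∑ j : Fin k, stageLogDensity M w (j.castLE hk) (τ.1 j)))
        ∂(rollout M π k hk ((0, z), s)) := by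
  have hmd : ∀ (k : ℕ) (hk : k ≤ H), Measurable fun τ : Traj S A k => ENNReal.ofReal
      (Real.exp (∑ j : Fin k, stageLogDensity M w (j.castLE hk) (τ.1 j))) := by
    intro k hk
    refine ENNReal.measurable_ofReal.comp (Real.measurable_exp.comp ?_)
    refine Finset.measurable_fun_sum _ fun h _ => ?_
    exact (measurable_stageLogDensity M (h.castLE hk)).comp
      (f := fun τ : Traj S A k => (w, τ.1 h)) (by fun_prop)
  induction k with
  | zero =>
    have hFm : Measurable fun τ => F τ * ENNReal.ofReal (Real.exp
        (∑ j, stageLogDensity M w (j.castLE hk) (τ.1 j))) := hF.mul (hmd _ _)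
    rw [lintegral_rollout_zero _ _ _ _ hF, lintegral_rollout_zero _ _ _ _ hFm]
    simp
  | succ k ih =>
    have hFe : Measurable fun x => F (extend k x) := hF.comp (measurable_extend k)
    have hFm : Measurable fun τ => F τ * ENNReal.ofReal (Real.exp
        (∑ j, stageLogDensity M w (j.castLE hk) (τ.1 j))) := hF.mul (hmd _ _)
    rw [lintegral_rollout_succ _ _ _ _ _ hF, lintegral_rollout_succ _ _ _ _ _ hFm]
    have hm₂ : Measurable fun p : (Traj S A k × A) × ℝ =>
        ∫⁻ s', F (extend k (p.1.1, (p.1.2, (p.2, s')))) ∂(M.trans ⟨k, hk⟩ (p.1.1.2, p.1.2)) := by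
      have : Measurable fun p : ((Traj S A k × A) × ℝ) × S =>
        F (extend k (p.1.1.1, (p.1.1.2, (p.1.2, p.2)))) := by fun_prop
      exact this.lintegral_kernel_prod_right' (κ := (M.trans ⟨k, hk⟩).comap
        (fun p : (Traj S A k × A) × ℝ => (p.1.1.2, p.1.2)) (by fun_prop))
    have hm₁ : Measurable fun p : Traj S A k × A =>
        ∫⁻ y, ∫⁻ s', F (extend k (p.1, (p.2, (y, s')))) ∂(M.trans ⟨k, hk⟩ (p.1.2, p.2))
          ∂(gaussianReal (inner ℝ (M.feat (p.1.2, p.2)) (w ⟨k, hk⟩)) 1) := by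
      have := hm₂.lintegral_kernel_prod_right' (κ := (obsKernel M ⟨k, hk⟩).comap
        (fun p : Traj S A k × A => (w, (p.1.2, p.2))) (by fun_prop))
      simpa only [Kernel.comap_apply, obsKernel_apply] using this
    have hm₀ : Measurable fun τ : Traj S A k =>
        ∫⁻ a, ∫⁻ y, ∫⁻ s', F (extend k (τ, (a, (y, s')))) ∂(M.trans ⟨k, hk⟩ (τ.2, a))
          ∂(gaussianReal (inner ℝ (M.feat (τ.2, a)) (w ⟨k, hk⟩)) 1)
          ∂(π.act ⟨k, hk⟩ (z, τ.2)) :=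
      hm₁.lintegral_kernel_prod_right' (κ := (π.act ⟨k, hk⟩).comap
        (fun τ : Traj S A k => (z, τ.2)) (by fun_prop))
    rw [ih (Nat.le_of_succ_le hk) hm₀]
    refine lintegral_congr fun τ => ?_
    rw [← lintegral_mul_const' _ _ ENNReal.ofReal_ne_top]
    refine lintegral_congr fun a => ?_
    have hy : Measurable fun y =>
        ∫⁻ s', F (extend k (τ, (a, (y, s')))) ∂(M.trans ⟨k, hk⟩ (τ.2, a)) :=
      hm₂.comp (f := fun y => ((τ, a), y)) (by fun_prop)
    rw [lintegral_gaussianReal_one _ hy, ← lintegral_mul_const' _ _ ENNReal.ofReal_ne_top]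
    simp only [Pi.zero_apply, inner_zero_right]
    refine lintegral_congr fun y => ?_
    simp only [Fin.sum_univ_castSucc, extend_fst_castSucc, extend_fst_last]
    rw [lintegral_mul_const' _ _ ENNReal.ofReal_ne_top, mul_assoc,
      ← ENNReal.ofReal_mul (Real.exp_pos _).le, ← Real.exp_add, add_comm]
    rfl

/-! ### Episodes -/

lemma lintegral_episode (M : Model S A H d) (π : CtxPolicy Z S A H) (w : Param H d) (z : Z)
    {F : Traj S A H → ℝ≥0∞} (hF : Measurable F) :
    ∫⁻ τ, F τ ∂(episode M π (w, z)) =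
      ∫⁻ s, ∫⁻ τ, F τ ∂(rollout M π H le_rfl ((w, z), s)) ∂M.init := by
  unfold episode
  rw [Kernel.lintegral_comp _ _ _ hF, Kernel.prod_apply, Kernel.id_apply, Kernel.const_apply,
    Measure.dirac_prod, lintegral_map (hF.lintegral_kernel) (by fun_prop)]

lemma lintegral_randEpisode (M : Model S A H d) (π : RandPolicy S A H) (w : Param H d)
    {F : Traj S A H → ℝ≥0∞} (hF : Measurable F) :
    ∫⁻ τ, F τ ∂(randEpisode M π w) =
      ∫⁻ u : I, ∫⁻ s, ∫⁻ τ, F τ ∂(rollout M π H le_rfl ((w, u), s)) ∂M.init := by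
  unfold randEpisode
  rw [Kernel.lintegral_comp _ _ _ hF, Kernel.prod_apply, Kernel.id_apply, Kernel.const_apply,
    Measure.dirac_prod, lintegral_map (hF.lintegral_kernel) (by fun_prop)]
  exact lintegral_congr fun u => lintegral_episode M π w u hF

lemma onlineKernel_apply (M : Model S A H d) (alg : Algorithm S A H) (t : ℕ) (w : Param H d)
    (η : Hist S A H t) :
    onlineKernel M alg t (w, η) = randEpisode M (playedPolicy alg t η) w := by
  refine Measure.ext_of_lintegral _ fun F hF => ?_
  rw [lintegral_randEpisode _ _ _ hF]
  unfold onlineKernel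
  rw [Kernel.lintegral_comp _ _ _ hF, Kernel.map_apply _ (MeasurableEquiv.measurable _),
    lintegral_map (hF.lintegral_kernel) (MeasurableEquiv.measurable _), Kernel.prod_apply,
    Kernel.id_apply, Kernel.const_apply, Measure.dirac_prod,
    lintegral_map ((hF.lintegral_kernel (κ := episode M (alg t))).fun_comp
      (MeasurableEquiv.measurable _)) (by fun_prop)]
  refine lintegral_congr fun u => ?_
  have : MeasurableEquiv.prodAssoc ((w, η), u) = (w, (η, u)) := rfl
  rw [this, lintegral_episode _ _ _ _ hF]
  refine lintegral_congr fun s => ?_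
  rw [playedPolicy, rollout_comap]

lemma lintegral_randEpisode_eraseObs (M : Model S A H d) (π : RandPolicy S A H) (w w' : Param H d)
    {F : (Fin H → S × A) × S → ℝ≥0∞} (hF : Measurable F) :
    ∫⁻ τ, F (eraseObs τ) ∂(randEpisode M π w) = ∫⁻ τ, F (eraseObs τ) ∂(randEpisode M π w') := by
  rw [lintegral_randEpisode _ _ _ (by fun_prop), lintegral_randEpisode _ _ _ (by fun_prop)]
  exact lintegral_congr fun u => lintegral_congr fun s =>
    lintegral_rollout_eraseObs M π H le_rfl w w' u s hF

lemma lintegral_randEpisode_obs (M : Model S A H d) (π : RandPolicy S A H) (w : Param H d)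
    (h : Fin H) {G : (S × A) × ℝ → ℝ≥0∞} (hG : Measurable G) :
    ∫⁻ τ, G (((τ.1 h).1, (τ.1 h).2.1), (τ.1 h).2.2) ∂(randEpisode M π w) =
      ∫⁻ τ, ∫⁻ y, G (((τ.1 h).1, (τ.1 h).2.1), y) ∂(gaussianReal (inner ℝ (featAt M τ h) (w h)) 1)
        ∂(randEpisode M π w) := by
  have hm : Measurable fun τ : Traj S A H => ∫⁻ y, G (((τ.1 h).1, (τ.1 h).2.1), y)
      ∂(gaussianReal (inner ℝ (featAt M τ h) (w h)) 1) := by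
    have h1 : Measurable fun p : Traj S A H × ℝ => G (((p.1.1 h).1, (p.1.1 h).2.1), p.2) := by
      fun_prop
    have := h1.lintegral_kernel_prod_right' (κ := (obsKernel M h).comap
      (fun τ : Traj S A H => (w, ((τ.1 h).1, (τ.1 h).2.1))) (by fun_prop))
    simpa only [Kernel.comap_apply, obsKernel_apply, featAt] using this
  rw [lintegral_randEpisode _ _ _ (by fun_prop), lintegral_randEpisode _ _ _ hm]
  exact lintegral_congr fun u => lintegral_congr fun s =>
    lintegral_rollout_obs M π H le_rfl w u s h hG

lemma lintegral_randEpisode_eq (M : Model S A H d) (π : RandPolicy S A H) (w : Param H d)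
    {F : Traj S A H → ℝ≥0∞} (hF : Measurable F) :
    ∫⁻ τ, F τ ∂(randEpisode M π w) =
      ∫⁻ τ, F τ * ENNReal.ofReal (Real.exp (logDensity M w τ)) ∂(randEpisode M π 0) := by
  have hm : Measurable fun τ : Traj S A H =>
      F τ * ENNReal.ofReal (Real.exp (logDensity M w τ)) := by
    have := (measurable_logDensity M).comp (f := fun τ : Traj S A H => (w, τ)) (by fun_prop)
    exact hF.mul (ENNReal.measurable_ofReal.comp (Real.measurable_exp.comp this))
  rw [lintegral_randEpisode _ _ _ hF, lintegral_randEpisode _ _ _ hm]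
  exact lintegral_congr fun u => lintegral_congr fun s =>
    lintegral_rollout_eq M π H le_rfl w u s hF

end

/-! ### Mutual information of an episode for a Gaussian parameter law. -/

section

variable {S A Z Z' : Type*} [MeasurableSpace S] [MeasurableSpace A] [MeasurableSpace Z]
  [MeasurableSpace Z'] {H d : ℕ}

lemma lintegral_one_add_sub_sq_gaussianReal (m : ℝ) (v : ℝ≥0) :
    ∫⁻ s, ENNReal.ofReal (1 + (s - m) ^ 2) ∂gaussianReal m v = ENNReal.ofReal (1 + v) := by
  have h2 := (memLp_id_gaussianReal (μ := m) (v := v) 2)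
  have hint : Integrable (fun s => (s - m) ^ 2) (gaussianReal m v) :=
    (h2.sub (memLp_const m)).integrable_sq
  have hv := variance_eq_integral (μ := gaussianReal m v) (X := id) (by fun_prop)
  rw [variance_id_gaussianReal] at hv
  simp only [id_eq, integral_id_gaussianReal] at hv
  have hint1 : Integrable (fun s => 1 + (s - m) ^ 2) (gaussianReal m v) :=
    (integrable_const _).add hint
  rw [← ofReal_integral_eq_lintegral_ofReal hint1
    (Filter.Eventually.of_forall fun s => by positivity),
    integral_add (integrable_const _) hint, ← hv]
  simp

@[fun_prop]
lemma measurable_featAt (M : Model S A H d) (h : Fin H) :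
    Measurable fun τ : Traj S A H => featAt M τ h := by
  have := M.measurable_feat
  unfold featAt
  fun_prop

lemma norm_featAt_le (M : Model S A H d) (τ : Traj S A H) (h : Fin H) : ‖featAt M τ h‖ ≤ 1 :=
  M.norm_feat_le _

/-- The product over the stages of the Gaussians with precision matrices `Λ h` and means
`(Λ h)⁻¹ (b h)`. -/
def paramGaussian (Λ : Fin H → Matrix (Fin d) (Fin d) ℝ) (b : Param H d) : Measure (Param H d) :=
  Measure.pi fun h => precGaussian (Λ h) (b h)

instance (Λ : Fin H → Matrix (Fin d) (Fin d) ℝ) (b : Param H d) :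
    IsProbabilityMeasure (paramGaussian Λ b) := by
  unfold paramGaussian
  infer_instance

/-- The mean of the stage parameter. -/
def precMean (Λ : Fin H → Matrix (Fin d) (Fin d) ℝ) (b : Param H d) (h : Fin H) :
    EuclideanSpace ℝ (Fin d) :=
  WithLp.toLp 2 ((Λ h)⁻¹ *ᵥ (b h).ofLp)

lemma map_inner_paramGaussian {Λ : Fin H → Matrix (Fin d) (Fin d) ℝ} (hΛ : ∀ h, (Λ h).PosDef)
    (b : Param H d) (h : Fin H) (x : EuclideanSpace ℝ (Fin d)) :
    (paramGaussian Λ b).map (fun w => inner ℝ x (w h)) =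
      gaussianReal (inner ℝ x (precMean Λ b h)) (quadForm (Λ h)⁻¹ x).toNNReal := by
  rw [← map_inner_multivariateGaussian _ (hΛ h).inv.posSemidef]
  have := (measurePreserving_eval (fun h => precGaussian (Λ h) (b h)) h).map_eq
  change _ = (precGaussian (Λ h) (b h)).map _
  rw [← this, Measure.map_map (by fun_prop) (by fun_prop)]
  rfl

/-- Log-density of the marginal law of a trajectory, for the parameter law `paramGaussian Λ b`,
with respect to the law under the parameter `0`. -/
def logEvidence (M : Model S A H d) (Λ : Fin H → Matrix (Fin d) (Fin d) ℝ) (b : Param H d)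
    (τ : Traj S A H) : ℝ :=
  ∑ h, ((τ.1 h).2.2 ^ 2 / 2 -
    ((τ.1 h).2.2 - inner ℝ (featAt M τ h) (precMean Λ b h)) ^ 2 /
      (2 * (1 + quadForm (Λ h)⁻¹ (featAt M τ h))) -
    Real.log (1 + quadForm (Λ h)⁻¹ (featAt M τ h)) / 2)

@[fun_prop]
lemma measurable_logEvidence (M : Model S A H d) (Λ : Fin H → Matrix (Fin d) (Fin d) ℝ)
    (b : Param H d) : Measurable (logEvidence M Λ b) := by
  unfold logEvidence
  fun_prop

/-- For a fixed trajectory the likelihood is a product over stages, each factor depending on w only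
through the real Gaussian ⟨φ_h, w_h⟩. Independence of the stages reduces the integral to the
one-dimensional evidence formula. -/
lemma lintegral_exp_logDensity (M : Model S A H d) {Λ : Fin H → Matrix (Fin d) (Fin d) ℝ}
    (hΛ : ∀ h, (Λ h).PosDef) (b : Param H d) (τ : Traj S A H) :
    ∫⁻ w, ENNReal.ofReal (Real.exp (logDensity M w τ)) ∂(paramGaussian Λ b) =
      ENNReal.ofReal (Real.exp (logEvidence M Λ b τ)) := by
  have hstage : ∀ h : Fin H, Integrable (fun u : EuclideanSpace ℝ (Fin d) =>
      Real.exp ((τ.1 h).2.2 * inner ℝ (featAt M τ h) u - (inner ℝ (featAt M τ h) u) ^ 2 / 2))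
        (precGaussian (Λ h) (b h)) ∧
      ∫ u, Real.exp ((τ.1 h).2.2 * inner ℝ (featAt M τ h) u -
          (inner ℝ (featAt M τ h) u) ^ 2 / 2) ∂(precGaussian (Λ h) (b h)) =
        Real.exp ((τ.1 h).2.2 ^ 2 / 2 -
          ((τ.1 h).2.2 - inner ℝ (featAt M τ h) (precMean Λ b h)) ^ 2 /
            (2 * (1 + quadForm (Λ h)⁻¹ (featAt M τ h))) -
          Real.log (1 + quadForm (Λ h)⁻¹ (featAt M τ h)) / 2) := by
    intro h
    have hmap := map_inner_multivariateGaussian (precMean Λ b h) (hΛ h).inv.posSemidef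
      (featAt M τ h)
    change (precGaussian (Λ h) (b h)).map _ = _ at hmap
    have hI := integrable_exp_quadratic (μ := (precGaussian (Λ h) (b h)).map
      (fun u => inner ℝ (featAt M τ h) u)) (τ.1 h).2.2
    refine ⟨hI.comp_measurable (by fun_prop), ?_⟩
    have := integral_exp_quadratic_gaussianReal (inner ℝ (featAt M τ h) (precMean Λ b h))
      (τ.1 h).2.2 (quadForm (Λ h)⁻¹ (featAt M τ h)).toNNReal
    rw [← hmap, integral_map (by fun_prop) (by fun_prop),
      Real.coe_toNNReal _ (quadForm_nonneg (hΛ h).inv.posSemidef _)] at this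
    exact this
  have hprod : ∀ w, Real.exp (logDensity M w τ) = ∏ h, Real.exp
      ((τ.1 h).2.2 * inner ℝ (featAt M τ h) (w h) - (inner ℝ (featAt M τ h) (w h)) ^ 2 / 2) := by
    intro w
    rw [← Real.exp_sum]
    rfl
  simp only [hprod]
  rw [← ofReal_integral_eq_lintegral_ofReal]
  · rw [paramGaussian, integral_fintype_prod_eq_prod (fun h u => Real.exp ((τ.1 h).2.2 *
      inner ℝ (featAt M τ h) u - (inner ℝ (featAt M τ h) u) ^ 2 / 2)), logEvidence, Real.exp_sum]
    congr 1
    exact Finset.prod_congr rfl fun h _ => (hstage h).2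
  · exact Integrable.fintype_prod_dep (f := fun h u => Real.exp ((τ.1 h).2.2 *
      inner ℝ (featAt M τ h) u - (inner ℝ (featAt M τ h) u) ^ 2 / 2)) fun h => (hstage h).1
  · exact Filter.Eventually.of_forall fun w => by positivity

/-- The information gained about the parameter along a trajectory. -/
def gainAt (M : Model S A H d) (Λ : Fin H → Matrix (Fin d) (Fin d) ℝ) (τ : Traj S A H) : ℝ :=
  ∑ h, Real.log (1 + quadForm (Λ h)⁻¹ (featAt M τ h)) / 2

@[fun_prop]
lemma measurable_gainAt (M : Model S A H d) (Λ : Fin H → Matrix (Fin d) (Fin d) ℝ) :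
    Measurable (gainAt M Λ) := by
  unfold gainAt
  fun_prop

lemma gainAt_nonneg (M : Model S A H d) {Λ : Fin H → Matrix (Fin d) (Fin d) ℝ}
    (hΛ : ∀ h, (Λ h).PosDef) (τ : Traj S A H) : 0 ≤ gainAt M Λ τ :=
  Finset.sum_nonneg fun h _ => div_nonneg (Real.log_nonneg (by
    linarith [quadForm_nonneg (hΛ h).inv.posSemidef (featAt M τ h)])) zero_le_two

lemma lintegral_comp_randEpisode (M : Model S A H d) (π : RandPolicy S A H)
    {Λ : Fin H → Matrix (Fin d) (Fin d) ℝ} (hΛ : ∀ h, (Λ h).PosDef) (b : Param H d)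
    {F : Traj S A H → ℝ≥0∞} (hF : Measurable F) :
    ∫⁻ τ, F τ ∂(randEpisode M π ∘ₘ paramGaussian Λ b) =
      ∫⁻ τ, F τ * ENNReal.ofReal (Real.exp (logEvidence M Λ b τ)) ∂(randEpisode M π 0) := by
  rw [Measure.lintegral_bind (Kernel.aemeasurable _) hF.aemeasurable]
  simp only [lintegral_randEpisode_eq M π _ hF]
  rw [lintegral_lintegral_swap]
  · refine lintegral_congr fun τ => ?_
    rw [lintegral_const_mul, lintegral_exp_logDensity M hΛ]
    have := (measurable_logDensity M).comp (f := fun w : Param H d => (w, τ)) (by fun_prop)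
    exact ENNReal.measurable_ofReal.comp (Real.measurable_exp.comp this)
  · refine Measurable.aemeasurable ?_
    have := measurable_logDensity M
    simp only [Function.uncurry_def]
    fun_prop

section InfoGain

variable (M : Model S A H d) (π : RandPolicy S A H) {Λ : Fin H → Matrix (Fin d) (Fin d) ℝ}
  (hΛ : ∀ h, (Λ h).PosDef) (b : Param H d)

include hΛ in
-- Likelihood over evidence, both relative to the law under the parameter 0, so that the reference
-- law cancels. The exponent is the integrand of the Kullback–Leibler divergence.
lemma compProd_randEpisode_eq_withDensity :
    paramGaussian Λ b ⊗ₘ randEpisode M π =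
      ((paramGaussian Λ b).prod (randEpisode M π ∘ₘ paramGaussian Λ b)).withDensity
        (fun p => ENNReal.ofReal (Real.exp (logDensity M p.1 p.2 - logEvidence M Λ b p.2))) := by
  refine Measure.ext_of_lintegral _ fun F hF => ?_
  have hm : Measurable fun p : Param H d × Traj S A H =>
      ENNReal.ofReal (Real.exp (logDensity M p.1 p.2 - logEvidence M Λ b p.2)) := by
    have := measurable_logDensity M
    fun_prop
  rw [lintegral_withDensity_eq_lintegral_mul _ hm hF, lintegral_prod _ (hm.mul hF).aemeasurable,
    Measure.lintegral_compProd hF]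
  refine lintegral_congr fun w => ?_
  have hFw : Measurable fun τ => F (w, τ) := by fun_prop
  refine (lintegral_randEpisode_eq M π w hFw).trans ?_
  refine Eq.trans ?_ (lintegral_comp_randEpisode M π hΛ b
    ((hm.mul hF).comp (measurable_prodMk_left (x := w)))).symm
  refine lintegral_congr fun τ => ?_
  simp only [Pi.mul_apply, Function.comp_apply]
  rw [mul_comm (ENNReal.ofReal _), mul_assoc, ← ENNReal.ofReal_mul (Real.exp_pos _).le,
    ← Real.exp_add, sub_add_cancel]

lemma lintegral_sub_inner_sq (h : Fin H) :
    ∫⁻ p, ENNReal.ofReal (((p.2.1 h).2.2 - inner ℝ (featAt M p.2 h) (p.1 h)) ^ 2)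
      ∂(paramGaussian Λ b ⊗ₘ randEpisode M π) = 1 := by
  rw [Measure.lintegral_compProd (by fun_prop)]
  have : ∀ w : Param H d, ∫⁻ τ, ENNReal.ofReal (((τ.1 h).2.2 - inner ℝ (featAt M τ h) (w h)) ^ 2)
      ∂(randEpisode M π w) = 1 := by
    intro w
    have hf := M.measurable_feat
    have e := lintegral_randEpisode_obs M π w h
      (G := fun q => ENNReal.ofReal ((q.2 - inner ℝ (M.feat q.1) (w h)) ^ 2)) (by fun_prop)
    refine e.trans ?_
    have e2 : ∀ τ : Traj S A H, ∫⁻ y, ENNReal.ofReal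
        ((y - inner ℝ (M.feat ((τ.1 h).1, (τ.1 h).2.1)) (w h)) ^ 2)
        ∂(gaussianReal (inner ℝ (featAt M τ h) (w h)) 1) = 1 := by
      intro τ
      rw [lintegral_sub_sq_gaussianReal_one]
      simp [featAt]
    simp [e2]
  simp [this]

include hΛ in
-- States and actions have a law free of w, so w keeps its law given φ_h. The residual about the
-- mean prediction then has variance 1 from the noise plus φᵀ Λ⁻¹ φ from the parameter.
lemma lintegral_sub_mean_sq (h : Fin H) :
    ∫⁻ p, ENNReal.ofReal (((p.2.1 h).2.2 - inner ℝ (featAt M p.2 h) (precMean Λ b h)) ^ 2 /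
        (1 + quadForm (Λ h)⁻¹ (featAt M p.2 h)))
      ∂(paramGaussian Λ b ⊗ₘ randEpisode M π) = 1 := by
  have hf := M.measurable_feat
  have hq : ∀ x, 0 < 1 + quadForm (Λ h)⁻¹ x := fun x => by
    linarith [quadForm_nonneg (hΛ h).inv.posSemidef x]
  rw [Measure.lintegral_compProd (by fun_prop)]
  let g : Param H d → (S × A) → ℝ≥0∞ := fun w x =>
    ENNReal.ofReal (1 + (inner ℝ (M.feat x) (w h) - inner ℝ (M.feat x) (precMean Λ b h)) ^ 2) *
      (ENNReal.ofReal (1 + quadForm (Λ h)⁻¹ (M.feat x)))⁻¹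
  have hg : Measurable fun p : Param H d × Traj S A H => g p.1 ((p.2.1 h).1, (p.2.1 h).2.1) := by
    fun_prop
  have e1 : ∀ w : Param H d, ∫⁻ τ, ENNReal.ofReal
      (((τ.1 h).2.2 - inner ℝ (featAt M τ h) (precMean Λ b h)) ^ 2 /
        (1 + quadForm (Λ h)⁻¹ (featAt M τ h))) ∂(randEpisode M π w) =
      ∫⁻ τ, g w ((τ.1 h).1, (τ.1 h).2.1) ∂(randEpisode M π 0) := by
    intro w
    have e := lintegral_randEpisode_obs M π w h (G := fun q => ENNReal.ofReal
      ((q.2 - inner ℝ (M.feat q.1) (precMean Λ b h)) ^ 2 / (1 + quadForm (Λ h)⁻¹ (M.feat q.1))))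
      (by fun_prop)
    refine e.trans ?_
    have e2 : ∀ τ : Traj S A H, ∫⁻ y, ENNReal.ofReal
        ((y - inner ℝ (M.feat ((τ.1 h).1, (τ.1 h).2.1)) (precMean Λ b h)) ^ 2 /
          (1 + quadForm (Λ h)⁻¹ (M.feat ((τ.1 h).1, (τ.1 h).2.1))))
        ∂(gaussianReal (inner ℝ (featAt M τ h) (w h)) 1) = g w ((τ.1 h).1, (τ.1 h).2.1) := by
      intro τ
      simp only [fun a => ENNReal.ofReal_div_of_pos (x := a) (hq (M.feat ((τ.1 h).1, (τ.1 h).2.1)))]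
      simp only [div_eq_mul_inv]
      rw [lintegral_mul_const _ (by fun_prop), lintegral_sub_sq_gaussianReal_one]
      rfl
    simp only [e2]
    exact lintegral_randEpisode_eraseObs M π w 0
      (F := fun q => g w (q.1 h)) (by fun_prop)
  simp only [e1]
  rw [lintegral_lintegral_swap hg.aemeasurable]
  have e3 : ∀ τ : Traj S A H, ∫⁻ w, g w ((τ.1 h).1, (τ.1 h).2.1) ∂(paramGaussian Λ b) = 1 := by
    intro τ
    have hx := map_inner_paramGaussian hΛ b h (featAt M τ h)
    have e4 := lintegral_one_add_sub_sq_gaussianReal (inner ℝ (featAt M τ h) (precMean Λ b h))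
      (quadForm (Λ h)⁻¹ (featAt M τ h)).toNNReal
    rw [← hx, lintegral_map (by fun_prop) (by fun_prop),
      Real.coe_toNNReal _ (quadForm_nonneg (hΛ h).inv.posSemidef _)] at e4
    simp only [g]
    rw [lintegral_mul_const _ (by fun_prop)]
    refine (congrArg (· * _) e4).trans ?_
    exact ENNReal.mul_inv_cancel (by simpa using hq _) ENNReal.ofReal_ne_top
  simp [e3]

include hΛ in
/-- The mutual information between the parameter and the trajectory for a Gaussian parameter
law. -/
lemma infoGain_paramGaussian (hq : ∀ h x, ‖x‖ ≤ 1 → quadForm (Λ h)⁻¹ x ≤ 1) :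
    infoGain M (paramGaussian Λ b) π =
      ∫⁻ τ, ENNReal.ofReal (gainAt M Λ τ) ∂(randEpisode M π 0) := by
  set P := paramGaussian Λ b ⊗ₘ randEpisode M π with hP
  set R := (paramGaussian Λ b).prod (randEpisode M π ∘ₘ paramGaussian Λ b) with hR
  let f : Param H d × Traj S A H → ℝ := fun p => logDensity M p.1 p.2 - logEvidence M Λ b p.2
  have hfm : Measurable f := by
    have := measurable_logDensity M
    fun_prop
  have hPR : P = R.withDensity (fun p => ENNReal.ofReal (Real.exp (f p))) :=
    compProd_randEpisode_eq_withDensity M π hΛ b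
  have hac : P ≪ R := by rw [hPR]; exact withDensity_absolutelyContinuous _ _
  have hllr : llr P R =ᵐ[P] f := by
    refine hac.ae_le ?_
    have h1 := Measure.rnDeriv_withDensity R
      (f := fun p => ENNReal.ofReal (Real.exp (f p))) (by fun_prop)
    rw [← hPR] at h1
    filter_upwards [h1] with p hp
    rw [llr, hp, ENNReal.toReal_ofReal (Real.exp_pos _).le, Real.log_exp]
  have hpos : ∀ h x, 0 < 1 + quadForm (Λ h)⁻¹ x := fun h x => by
    linarith [quadForm_nonneg (hΛ h).inv.posSemidef x]
  let f₁ : Fin H → Param H d × Traj S A H → ℝ := fun h p =>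
    ((p.2.1 h).2.2 - inner ℝ (featAt M p.2 h) (p.1 h)) ^ 2
  let f₂ : Fin H → Param H d × Traj S A H → ℝ := fun h p =>
    ((p.2.1 h).2.2 - inner ℝ (featAt M p.2 h) (precMean Λ b h)) ^ 2 /
      (1 + quadForm (Λ h)⁻¹ (featAt M p.2 h))
  -- The standardised squared residuals about the mean prediction and about the true one both have
  -- expectation 1. They cancel in expectation and leave only the logarithmic term.
  have hf : ∀ p, f p = (∑ h, (1 / 2 * f₂ h p - 1 / 2 * f₁ h p)) + gainAt M Λ p.2 := by
    intro p
    simp only [f, f₁, f₂, gainAt, logDensity, logEvidence, ← Finset.sum_sub_distrib,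
      ← Finset.sum_add_distrib, stageLogDensity]
    refine Finset.sum_congr rfl fun h _ => ?_
    have := (hpos h (featAt M p.2 h)).ne'
    simp only [featAt] at this ⊢
    field_simp
    ring
  have hof : ∀ (g : Param H d × Traj S A H → ℝ), Measurable g → (∀ p, 0 ≤ g p) →
      ∫⁻ p, ENNReal.ofReal (g p) ∂P = 1 → Integrable g P ∧ ∫ p, g p ∂P = 1 := by
    intro g hg h0 h1
    refine ⟨(lintegral_ofReal_ne_top_iff_integrable hg.aestronglyMeasurable
      (Filter.Eventually.of_forall h0)).1 (by simp [h1]), ?_⟩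
    rw [integral_eq_lintegral_of_nonneg_ae (Filter.Eventually.of_forall h0)
      hg.aestronglyMeasurable, h1, ENNReal.toReal_one]
  have hI₁ := fun h => hof (f₁ h) (by simp only [f₁]; fun_prop) (fun p => sq_nonneg _)
    (lintegral_sub_inner_sq M π b h)
  have hI₂ := fun h => hof (f₂ h) (by simp only [f₂]; fun_prop)
    (fun p => div_nonneg (sq_nonneg _) (hpos _ _).le) (lintegral_sub_mean_sq M π hΛ b h)
  have hgi : Integrable (fun p : Param H d × Traj S A H => gainAt M Λ p.2) P := by
    refine Integrable.of_bound (C := ∑ _h : Fin H, (1 : ℝ) / 2)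
      ((measurable_gainAt M Λ).comp measurable_snd).aestronglyMeasurable
      (Filter.Eventually.of_forall fun p => ?_)
    rw [Real.norm_of_nonneg (gainAt_nonneg M hΛ _)]
    refine Finset.sum_le_sum fun h _ => ?_
    have h1 := Real.log_le_sub_one_of_pos (hpos h (featAt M p.2 h))
    have h2 := hq h _ (norm_featAt_le M p.2 h)
    linarith
  have hsi : ∀ h ∈ Finset.univ,
      Integrable (fun p => 1 / 2 * f₂ h p - 1 / 2 * f₁ h p) P :=
    fun h _ => ((hI₂ h).1.const_mul _).sub ((hI₁ h).1.const_mul _)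
  have hfi : Integrable f P := by
    rw [funext hf]
    exact (integrable_finsetSum _ hsi).add hgi
  have hint : ∫ p, f p ∂P = ∫ p, gainAt M Λ p.2 ∂P := by
    rw [funext hf, integral_add (integrable_finsetSum _ hsi) hgi, integral_finsetSum _ hsi]
    have : ∀ h, ∫ p, (1 / 2 * f₂ h p - 1 / 2 * f₁ h p) ∂P = 0 := by
      intro h
      rw [integral_sub ((hI₂ h).1.const_mul _) ((hI₁ h).1.const_mul _), integral_const_mul,
        integral_const_mul, (hI₁ h).2, (hI₂ h).2, sub_self]
    rw [Finset.sum_eq_zero fun h _ => this h, zero_add]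
  have : IsProbabilityMeasure P := by rw [hP]; infer_instance
  have : IsProbabilityMeasure R := by rw [hR]; infer_instance
  rw [infoGain, InformationTheory.klDiv_of_ac_of_integrable hac (hfi.congr hllr.symm),
    integral_congr_ae hllr, hint]
  simp only [probReal_univ, add_sub_cancel_right]
  rw [ofReal_integral_eq_lintegral_ofReal hgi
    (Filter.Eventually.of_forall fun p => gainAt_nonneg M hΛ _), hP,
    Measure.lintegral_compProd (by fun_prop)]
  -- The gain involves only states and actions, so averaging over w changes nothing.
  have e : ∀ w, ∫⁻ τ, ENNReal.ofReal (gainAt M Λ τ) ∂(randEpisode M π w) =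
      ∫⁻ τ, ENNReal.ofReal (gainAt M Λ τ) ∂(randEpisode M π 0) := by
    intro w
    have hf := M.measurable_feat
    exact lintegral_randEpisode_eraseObs M π w 0 (F := fun q => ENNReal.ofReal
      (∑ h, Real.log (1 + quadForm (Λ h)⁻¹ (M.feat (q.1 h))) / 2)) (by fun_prop)
  simp [e]

end InfoGain

end

/-! ### The Gaussian posterior given the offline data and the history. -/

section

section Quadratic

variable {ι : Type*} [Fintype ι]

lemma dotProduct_ofLp (x y : EuclideanSpace ℝ ι) : x.ofLp ⬝ᵥ y.ofLp = inner ℝ x y := by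
  rw [EuclideanSpace.inner_eq_star_dotProduct, dotProduct_comm]
  simp

lemma quadExp_add (A B : Matrix ι ι ℝ) (a b w : EuclideanSpace ℝ ι) :
    quadExp (A + B) (a + b) w = quadExp A a w + quadExp B b w := by
  simp only [quadExp, add_mulVec, dotProduct_add, WithLp.ofLp_add, add_dotProduct]
  ring

lemma quadExp_zero (w : EuclideanSpace ℝ ι) : quadExp (0 : Matrix ι ι ℝ) 0 w = 0 := by
  simp [quadExp]

lemma quadExp_sum {κ : Type*} (s : Finset κ) (A : κ → Matrix ι ι ℝ) (a : κ → EuclideanSpace ℝ ι)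
    (w : EuclideanSpace ℝ ι) :
    quadExp (∑ i ∈ s, A i) (∑ i ∈ s, a i) w = ∑ i ∈ s, quadExp (A i) (a i) w := by
  classical
  induction s using Finset.induction_on with
  | empty => simp [quadExp_zero]
  | insert i s hi ih => simp only [Finset.sum_insert hi, quadExp_add, ih]

lemma quadForm_vecMulVec (x w : EuclideanSpace ℝ ι) :
    quadForm (vecMulVec (fun j => x j) (fun j => x j)) w = inner ℝ x w ^ 2 := by
  rw [quadForm, vecMulVec_mulVec, ← dotProduct_ofLp]
  simp only [op_smul_eq_smul, dotProduct_smul]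
  rw [dotProduct_comm w.ofLp]
  simp [pow_two]

lemma quadExp_vecMulVec (x w : EuclideanSpace ℝ ι) (y : ℝ) :
    quadExp (vecMulVec (fun j => x j) (fun j => x j)) (y • x) w =
      y * inner ℝ x w - inner ℝ x w ^ 2 / 2 := by
  have h := quadForm_vecMulVec x w
  rw [quadForm] at h
  rw [quadExp, h, dotProduct_ofLp, real_inner_smul_left]
  ring

lemma posSemidef_vecMulVec (x : EuclideanSpace ℝ ι) :
    (vecMulVec (fun j => x j) (fun j => x j)).PosSemidef := by
  have := posSemidef_vecMulVec_self_star (fun j => x j)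
  simpa using this

variable [DecidableEq ι]

/-- With u = Λ⁻¹x, both xᵀΛ⁻¹x and uᵀΛu equal ⟨x, u⟩, which is at most ‖x‖‖u‖ and at least c‖u‖²;
eliminate ‖u‖. -/
lemma quadForm_inv_le {Λ : Matrix ι ι ℝ} (hΛ : Λ.PosDef) {c : ℝ} (hc : 0 < c)
    (h : ∀ u, c * ‖u‖ ^ 2 ≤ quadForm Λ u) (x : EuclideanSpace ℝ ι) :
    quadForm Λ⁻¹ x ≤ ‖x‖ ^ 2 / c := by
  set u : EuclideanSpace ℝ ι := WithLp.toLp 2 (Λ⁻¹ *ᵥ x.ofLp) with hu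
  have h1 : quadForm Λ⁻¹ x = inner ℝ x u := by rw [← dotProduct_ofLp]; rfl
  have h2 : quadForm Λ u = inner ℝ x u := by
    rw [quadForm, hu]
    simp only [mulVec_mulVec, mul_nonsing_inv _ hΛ.det_pos.ne'.isUnit, one_mulVec]
    rw [← h1, quadForm, dotProduct_comm]
  have h3 := h u
  rw [h2] at h3
  have h4 : inner ℝ x u ≤ ‖x‖ * ‖u‖ := real_inner_le_norm x u
  rw [h1, le_div_iff₀ hc]
  nlinarith [sq_nonneg (‖x‖ - c * ‖u‖)]

end Quadratic

variable {S A : Type*} [MeasurableSpace S] [MeasurableSpace A] {H d : ℕ}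

/-- The Gram matrix of the offline data and the history. -/
def histGram (M : Model S A H d) (lam : ℝ) (D : Dataset S A H) {t : ℕ} (ω : Hist S A H t)
    (h : Fin H) : Matrix (Fin d) (Fin d) ℝ :=
  gram M lam D h +
    ∑ i, vecMulVec (fun j => featAt M (ω i) h j) (fun j => featAt M (ω i) h j)

/-- The sum of observations times features over the offline data and the history. -/
def histLin (M : Model S A H d) (D : Dataset S A H) {t : ℕ} (ω : Hist S A H t) : Param H d :=
  fun h => ∑ i, (D.data h i).2.2 • offFeat M D h i + ∑ i, ((ω i).1 h).2.2 • featAt M (ω i) h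

lemma posDef_gram (M : Model S A H d) {lam : ℝ} (hlam : 0 < lam) (D : Dataset S A H) (h : Fin H) :
    (gram M lam D h).PosDef :=
  (PosDef.one.smul hlam).add_posSemidef
    (posSemidef_sum _ fun i _ => posSemidef_vecMulVec (offFeat M D h i))

lemma posDef_histGram (M : Model S A H d) {lam : ℝ} (hlam : 0 < lam) (D : Dataset S A H) {t : ℕ}
    (ω : Hist S A H t) (h : Fin H) : (histGram M lam D ω h).PosDef :=
  (posDef_gram M hlam D h).add_posSemidef
    (posSemidef_sum _ fun i _ => posSemidef_vecMulVec (featAt M (ω i) h))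

lemma quadForm_add {ι : Type*} [Fintype ι] (A B : Matrix ι ι ℝ) (w : EuclideanSpace ℝ ι) :
    quadForm (A + B) w = quadForm A w + quadForm B w := by
  simp [quadForm, add_mulVec, dotProduct_add]

lemma le_quadForm_histGram (M : Model S A H d) (lam : ℝ) (D : Dataset S A H) {t : ℕ}
    (ω : Hist S A H t) (h : Fin H) (u : EuclideanSpace ℝ (Fin d)) :
    lam * ‖u‖ ^ 2 ≤ quadForm (histGram M lam D ω h) u := by
  have h1 := quadForm_nonneg
    (posSemidef_sum Finset.univ fun i _ => posSemidef_vecMulVec (offFeat M D h i)) u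
  have h2 := quadForm_nonneg
    (posSemidef_sum Finset.univ fun i _ => posSemidef_vecMulVec (featAt M (ω i) h)) u
  have h3 : quadForm (lam • (1 : Matrix (Fin d) (Fin d) ℝ)) u = lam * ‖u‖ ^ 2 := by
    rw [quadForm, smul_mulVec, one_mulVec, dotProduct_smul, dotProduct_ofLp,
      real_inner_self_eq_norm_sq, smul_eq_mul]
  rw [histGram, gram, quadForm_add, quadForm_add, h3]
  linarith

/-- The role of λ ≥ 1: predictive variances stay in [0,1], the range in which log(1 + x) is at least
x log 2. -/
lemma quadForm_histGram_inv_le_one (M : Model S A H d) {lam : ℝ} (hlam : 1 ≤ lam)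
    (D : Dataset S A H) {t : ℕ} (ω : Hist S A H t) (h : Fin H) (x : EuclideanSpace ℝ (Fin d))
    (hx : ‖x‖ ≤ 1) : quadForm (histGram M lam D ω h)⁻¹ x ≤ 1 := by
  refine (quadForm_inv_le (posDef_histGram M (by linarith) D ω h) one_pos (fun u => ?_) x).trans ?_
  · refine le_trans ?_ (le_quadForm_histGram M lam D ω h u)
    gcongr
  · rw [div_one]
    exact pow_le_one₀ (norm_nonneg _) hx

/-- Log-density of the history under the parameter `w` with respect to the parameter `0`. -/
def histLogDensity (M : Model S A H d) (w : Param H d) {t : ℕ} (ω : Hist S A H t) : ℝ :=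
  ∑ i, logDensity M w (ω i)

@[fun_prop]
lemma measurable_histLogDensity (M : Model S A H d) (t : ℕ) :
    Measurable fun p : Param H d × Hist S A H t => histLogDensity M p.1 p.2 := by
  unfold histLogDensity
  refine Finset.measurable_fun_sum _ fun i _ => ?_
  exact (measurable_logDensity M).comp
    (f := fun p : Param H d × Hist S A H t => (p.1, p.2 i)) (by fun_prop)

lemma prior_eq_tilted (H d : ℕ) {lam : ℝ} (hlam : 0 < lam) :
    prior H d lam = (Measure.pi fun _ => volume).tilted
      (fun w => ∑ h, quadExp (lam • (1 : Matrix (Fin d) (Fin d) ℝ)) 0 (w h)) := by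
  have hpd : (lam • (1 : Matrix (Fin d) (Fin d) ℝ)).PosDef := PosDef.one.smul hlam
  have h1 : multivariateGaussian 0 (lam⁻¹ • (1 : Matrix (Fin d) (Fin d) ℝ)) =
      precGaussian (lam • (1 : Matrix (Fin d) (Fin d) ℝ)) 0 := by
    have h2 : (lam • (1 : Matrix (Fin d) (Fin d) ℝ))⁻¹ = lam⁻¹ • 1 :=
      inv_eq_right_inv (by simp [smul_smul, hlam.ne'])
    rw [precGaussian, h2]
    simp
  rw [prior, ← pi_tilted (fun _ : Fin H => (volume : Measure (EuclideanSpace ℝ (Fin d)))) _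
    fun _ => integrable_exp_quadExp hpd 0]
  congr with h : 1
  rw [h1, precGaussian_eq_tilted hpd]

lemma measurable_logLik (M : Model S A H d) (D : Dataset S A H) : Measurable (logLik M D) := by
  unfold logLik
  fun_prop

lemma integrable_exp_logLik (M : Model S A H d) (D : Dataset S A H) (μ : Measure (Param H d))
    [IsFiniteMeasure μ] : Integrable (fun w => Real.exp (logLik M D w)) μ := by
  refine Integrable.of_bound (C := 1)
    (Real.measurable_exp.comp (measurable_logLik M D)).aestronglyMeasurable
    (Filter.Eventually.of_forall fun w => ?_)
  have h0 : 0 ≤ ∑ h, ∑ i, ((D.data h i).2.2 - inner ℝ (offFeat M D h i) (w h)) ^ 2 :=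
    Finset.sum_nonneg fun h _ => Finset.sum_nonneg fun i _ => sq_nonneg _
  rw [Real.norm_eq_abs, Real.abs_exp, Real.exp_le_one_iff, logLik]
  linarith

lemma integrable_exp_histLogDensity (M : Model S A H d) {t : ℕ} (ω : Hist S A H t)
    (μ : Measure (Param H d)) [IsFiniteMeasure μ] :
    Integrable (fun w => Real.exp (histLogDensity M w ω)) μ := by
  refine Integrable.of_bound (C := Real.exp (∑ i, ∑ h, ((ω i).1 h).2.2 ^ 2 / 2))
    (Real.measurable_exp.comp ((measurable_histLogDensity M t).comp
      (f := fun w => (w, ω)) (by fun_prop))).aestronglyMeasurable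
    (Filter.Eventually.of_forall fun w => ?_)
  rw [Real.norm_eq_abs, Real.abs_exp, Real.exp_le_exp]
  refine Finset.sum_le_sum fun i _ => Finset.sum_le_sum fun h _ => ?_
  rw [stageLogDensity]
  nlinarith [sq_nonneg (((ω i).1 h).2.2 -
    inner ℝ (M.feat (((ω i).1 h).1, ((ω i).1 h).2.1)) (w h))]

/-- The posterior given the offline data and the history is Gaussian. -/
lemma offPosterior_tilted_eq (M : Model S A H d) {lam : ℝ} (hlam : 0 < lam) (D : Dataset S A H)
    {t : ℕ} (ω : Hist S A H t) :
    (offPosterior M lam D).tilted (fun w => histLogDensity M w ω) =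
      paramGaussian (histGram M lam D ω) (histLin M D ω) := by
  have hpd : (lam • (1 : Matrix (Fin d) (Fin d) ℝ)).PosDef := PosDef.one.smul hlam
  have hpt : paramGaussian (histGram M lam D ω) (histLin M D ω) =
      (Measure.pi fun _ => volume).tilted
        (fun w => ∑ h, quadExp (histGram M lam D ω h) (histLin M D ω h) (w h)) := by
    rw [← pi_tilted (fun _ : Fin H => (volume : Measure (EuclideanSpace ℝ (Fin d)))) _
      fun h => integrable_exp_quadExp (posDef_histGram M hlam D ω h) (histLin M D ω h),
      paramGaussian]
    congr with h : 1
    exact precGaussian_eq_tilted (posDef_histGram M hlam D ω h) _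
  have hint : Integrable (fun w : Param H d => Real.exp
      (∑ h, quadExp (lam • (1 : Matrix (Fin d) (Fin d) ℝ)) 0 (w h)))
      (Measure.pi fun _ => volume) := by
    simp only [Real.exp_sum]
    exact Integrable.fintype_prod_dep (f := fun _ u => Real.exp (quadExp _ 0 u))
      fun _ => integrable_exp_quadExp hpd 0
  -- Prior, offline likelihood and history likelihood become successive tilts of Lebesgue measure,
  -- so their exponents add. The squares of the offline observations do not involve w and are
  -- absorbed as an additive constant.
  rw [offPosterior, tilted_tilted (integrable_exp_logLik M D _), prior_eq_tilted H d hlam,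
    tilted_tilted hint, hpt,
    ← tilted_add_const _ _ (1 / 2 * ∑ h, ∑ i, ((D.data h i).2.2) ^ 2)]
  congr with w
  simp only [Pi.add_apply, histGram, histLin, gram]
  have e : ∀ h, quadExp (lam • (1 : Matrix (Fin d) (Fin d) ℝ) +
        ∑ i, vecMulVec (fun j => offFeat M D h i j) (fun j => offFeat M D h i j) +
        ∑ i, vecMulVec (fun j => featAt M (ω i) h j) (fun j => featAt M (ω i) h j))
      (∑ i, (D.data h i).2.2 • offFeat M D h i + ∑ i, ((ω i).1 h).2.2 • featAt M (ω i) h) (w h) =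
      quadExp (lam • (1 : Matrix (Fin d) (Fin d) ℝ)) 0 (w h) +
        ∑ i, ((D.data h i).2.2 * inner ℝ (offFeat M D h i) (w h) -
          inner ℝ (offFeat M D h i) (w h) ^ 2 / 2) +
        ∑ i, stageLogDensity M w h ((ω i).1 h) := by
    intro h
    rw [quadExp_add, ← zero_add (∑ i, (D.data h i).2.2 • offFeat M D h i), quadExp_add,
      quadExp_sum, quadExp_sum]
    simp only [quadExp_vecMulVec]
    rfl
  simp only [e, Finset.sum_add_distrib, histLogDensity, logDensity, logLik]
  rw [Finset.sum_comm (s := (Finset.univ : Finset (Fin t)))]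
  have e2 : -(1 / 2) * ∑ h, ∑ i, ((D.data h i).2.2 - inner ℝ (offFeat M D h i) (w h)) ^ 2 =
      ∑ h, ∑ i, ((D.data h i).2.2 * inner ℝ (offFeat M D h i) (w h) -
          inner ℝ (offFeat M D h i) (w h) ^ 2 / 2) +
        -(1 / 2) * ∑ h, ∑ i, ((D.data h i).2.2) ^ 2 := by
    rw [Finset.mul_sum, Finset.mul_sum, ← Finset.sum_add_distrib]
    refine Finset.sum_congr rfl fun h _ => ?_
    rw [Finset.mul_sum, Finset.mul_sum, ← Finset.sum_add_distrib]
    exact Finset.sum_congr rfl fun i _ => by ring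
  rw [e2]
  ring

section Joint

variable (M : Model S A H d) (lam : ℝ) (D : Dataset S A H) (alg : Algorithm S A H)

lemma measurable_snoc_hist (t : ℕ) : Measurable fun x : Hist S A H t × Traj S A H =>
    Fin.snoc (α := fun _ => Traj S A H) x.1 x.2 :=
  measurable_snoc (X := Traj S A H) t

lemma lintegral_jointLaw_zero {F : Param H d × Hist S A H 0 → ℝ≥0∞} (hF : Measurable F) :
    ∫⁻ p, F p ∂(jointLaw M lam D alg 0) = ∫⁻ w, F (w, Fin.elim0) ∂(offPosterior M lam D) := by
  rw [jointLaw, lintegral_map hF (by fun_prop)]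

lemma lintegral_jointLaw_succ (t : ℕ) {F : Param H d × Hist S A H (t + 1) → ℝ≥0∞}
    (hF : Measurable F) :
    ∫⁻ p, F p ∂(jointLaw M lam D alg (t + 1)) =
      ∫⁻ p, ∫⁻ τ, F (p.1, Fin.snoc (α := fun _ => Traj S A H) p.2 τ)
        ∂(onlineKernel M alg t p) ∂(jointLaw M lam D alg t) := by
  have hs : Measurable fun x : (Param H d × Hist S A H t) × Traj S A H =>
      (x.1.1, Fin.snoc (α := fun _ => Traj S A H) x.1.2 x.2) :=
    Measurable.prodMk (by fun_prop) ((measurable_snoc_hist t).comp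
      (f := fun x : (Param H d × Hist S A H t) × Traj S A H => (x.1.2, x.2)) (by fun_prop))
  rw [jointLaw, lintegral_map hF hs, Measure.lintegral_compProd
    (f := fun x : (Param H d × Hist S A H t) × Traj S A H =>
      F (x.1.1, Fin.snoc (α := fun _ => Traj S A H) x.1.2 x.2)) (hF.comp hs)]

/-- The law of the history under the parameter `0`. -/
def refLaw : (t : ℕ) → Measure (Hist S A H t)
  | 0 => Measure.dirac Fin.elim0
  | t + 1 => ((refLaw t) ⊗ₘ ((onlineKernel M alg t).comap (fun ω => (0, ω)) (by fun_prop))).map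
      (fun x => Fin.snoc (α := fun _ => Traj S A H) x.1 x.2)

instance (t : ℕ) : IsProbabilityMeasure (refLaw M alg t) := by
  induction t with
  | zero => unfold refLaw; infer_instance
  | succ t ih =>
    unfold refLaw
    exact Measure.isProbabilityMeasure_map (measurable_snoc_hist t).aemeasurable

lemma lintegral_refLaw_succ (t : ℕ) {F : Hist S A H (t + 1) → ℝ≥0∞} (hF : Measurable F) :
    ∫⁻ ω, F ω ∂(refLaw M alg (t + 1)) =
      ∫⁻ ω, ∫⁻ τ, F (Fin.snoc (α := fun _ => Traj S A H) ω τ) ∂(onlineKernel M alg t (0, ω))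
        ∂(refLaw M alg t) := by
  rw [refLaw, lintegral_map hF (measurable_snoc_hist t),
    Measure.lintegral_compProd (f := fun x => F (Fin.snoc (α := fun _ => Traj S A H) x.1 x.2))
      (hF.comp (measurable_snoc_hist t))]
  rfl

lemma histLogDensity_snoc (w : Param H d) {t : ℕ} (ω : Hist S A H t) (τ : Traj S A H) :
    histLogDensity M w (Fin.snoc (α := fun _ => Traj S A H) ω τ) =
      histLogDensity M w ω + logDensity M w τ := by
  simp [histLogDensity, Fin.sum_univ_castSucc]

/-- The rule sees the parameter only through the history, so after a given history it plays the same
policy under w and under 0, and the episode likelihood ratios multiply. All history laws thus have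
densities against one reference law independent of w. -/
lemma lintegral_jointLaw (t : ℕ) {F : Param H d × Hist S A H t → ℝ≥0∞} (hF : Measurable F) :
    ∫⁻ p, F p ∂(jointLaw M lam D alg t) =
      ∫⁻ w, ∫⁻ ω, F (w, ω) * ENNReal.ofReal (Real.exp (histLogDensity M w ω)) ∂(refLaw M alg t)
        ∂(offPosterior M lam D) := by
  induction t with
  | zero =>
    have hm : ∀ w : Param H d, Measurable fun ω : Hist S A H 0 =>
        F (w, ω) * ENNReal.ofReal (Real.exp (histLogDensity M w ω)) := by
      intro w
      have := measurable_histLogDensity M 0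
      fun_prop
    rw [lintegral_jointLaw_zero _ _ _ _ hF]
    refine lintegral_congr fun w => ?_
    rw [refLaw, lintegral_dirac' _ (hm w)]
    simp [histLogDensity]
  | succ t ih =>
    have hs : Measurable fun x : (Param H d × Hist S A H t) × Traj S A H =>
        F (x.1.1, Fin.snoc (α := fun _ => Traj S A H) x.1.2 x.2) :=
      hF.comp (Measurable.prodMk (by fun_prop) ((measurable_snoc_hist t).comp
        (f := fun x : (Param H d × Hist S A H t) × Traj S A H => (x.1.2, x.2)) (by fun_prop)))
    have hm : ∀ w : Param H d, Measurable fun ω : Hist S A H (t + 1) =>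
        F (w, ω) * ENNReal.ofReal (Real.exp (histLogDensity M w ω)) := by
      intro w
      have := measurable_histLogDensity M (t + 1)
      fun_prop
    rw [lintegral_jointLaw_succ _ _ _ _ _ hF, ih (hs.lintegral_kernel_prod_right')]
    refine lintegral_congr fun w => ?_
    rw [lintegral_refLaw_succ _ _ _ (hm w)]
    refine lintegral_congr fun ω => ?_
    rw [onlineKernel_apply, onlineKernel_apply, lintegral_randEpisode_eq _ _ _
      (F := fun τ => F (w, Fin.snoc (α := fun _ => Traj S A H) ω τ))
      (hs.comp (measurable_prodMk_left (x := (w, ω)))),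
      ← lintegral_mul_const' _ _ ENNReal.ofReal_ne_top]
    refine lintegral_congr fun τ => ?_
    rw [histLogDensity_snoc, add_comm (histLogDensity M w ω), Real.exp_add,
      ENNReal.ofReal_mul (Real.exp_pos _).le, ← mul_assoc]

/-- Bayes' formula: the offline posterior tilted by the history likelihood is a Markov kernel that
disintegrates the joint law. Regular conditional laws are almost surely unique, and the tilt is
already known to be Gaussian. -/
lemma posteriorAt_ae_eq {lam : ℝ} (hlam : 0 < lam) (t : ℕ) :
    ∀ᵐ ω ∂(histLaw M lam D alg t),
      posteriorAt M lam D alg t ω = paramGaussian (histGram M lam D ω) (histLin M D ω) := by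
  set β := offPosterior M lam D with hβ
  let e : Hist S A H t → Param H d → ℝ := fun ω w => Real.exp (histLogDensity M w ω)
  let Z : Hist S A H t → ℝ := fun ω => ∫ w, e ω w ∂β
  have hem : Measurable (Function.uncurry e) := by
    have := measurable_histLogDensity (S := S) (A := A) M t
    simp only [Function.uncurry_def, e]
    fun_prop
  have hZm : Measurable Z := (hem.stronglyMeasurable.integral_prod_right).measurable
  have heI : ∀ ω, Integrable (e ω) β := fun ω => integrable_exp_histLogDensity M ω β
  have hZpos : ∀ ω, 0 < Z ω := fun ω => integral_exp_pos (heI ω)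
  have hZ : ∀ ω, ∫⁻ w, ENNReal.ofReal (e ω w) ∂β = ENNReal.ofReal (Z ω) := fun ω =>
    (ofReal_integral_eq_lintegral_ofReal (heI ω)
      (Filter.Eventually.of_forall fun w => (Real.exp_pos _).le)).symm
  let f : Hist S A H t → Param H d → ℝ≥0∞ := fun ω w => ENNReal.ofReal (e ω w / Z ω)
  have hfm : Measurable (Function.uncurry f) := by
    simp only [Function.uncurry_def, f] at hem ⊢
    fun_prop
  let κ : Kernel (Hist S A H t) (Param H d) := (Kernel.const _ β).withDensity f
  have hκt : ∀ ω, κ ω = β.tilted (fun w => histLogDensity M w ω) := by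
    intro ω
    simp only [κ]
    rw [Kernel.withDensity_apply _ hfm, Kernel.const_apply]
    rfl
  have hκ : IsMarkovKernel κ := ⟨fun ω => by
    rw [hκt, offPosterior_tilted_eq M hlam]
    infer_instance⟩
  have hjoint : (jointLaw M lam D alg t).map (fun x => (Prod.snd x, Prod.fst x)) =
      (jointLaw M lam D alg t).map Prod.snd ⊗ₘ κ := by
    refine Measure.ext_of_lintegral _ fun F hF => ?_
    have hFκ : Measurable fun ω => ∫⁻ w, F (ω, w) ∂(κ ω) := hF.lintegral_kernel_prod_right'
    have hswap : Measurable fun p : Param H d × Hist S A H t => F (p.2, p.1) := by fun_prop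
    have hsnd : Measurable fun p : Param H d × Hist S A H t => ∫⁻ w, F (p.2, w) ∂(κ p.2) :=
      hFκ.comp measurable_snd
    have hem' : Measurable fun p : Param H d × Hist S A H t =>
        ENNReal.ofReal (Real.exp (histLogDensity M p.1 p.2)) := by
      have := measurable_histLogDensity (S := S) (A := A) M t
      fun_prop
    -- Since the reference law does not depend on w, Tonelli puts the history outside; the identity
    -- can then be checked for each history, where the normaliser `Z ω` cancels.
    have sw : ∀ G : Param H d × Hist S A H t → ℝ≥0∞, Measurable G →
        ∫⁻ w, ∫⁻ ω, G (w, ω) * ENNReal.ofReal (Real.exp (histLogDensity M w ω)) ∂(refLaw M alg t) ∂β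
          = ∫⁻ ω, ∫⁻ w, G (w, ω) * ENNReal.ofReal (e ω w) ∂β ∂(refLaw M alg t) :=
      fun G hG => lintegral_lintegral_swap
        (f := fun w ω => G (w, ω) * ENNReal.ofReal (Real.exp (histLogDensity M w ω)))
        (hG.mul hem').aemeasurable
    rw [lintegral_map hF (by fun_prop), lintegral_jointLaw _ _ _ _ _ hswap,
      Measure.lintegral_compProd hF, lintegral_map hFκ measurable_snd,
      lintegral_jointLaw _ _ _ _ _ hsnd]
    refine (sw (fun p => F (p.2, p.1)) hswap).trans
      (Eq.trans ?_ (sw (fun p => ∫⁻ w, F (p.2, w) ∂(κ p.2)) hsnd).symm)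
    refine lintegral_congr fun ω => ?_
    change ∫⁻ w, F (ω, w) * ENNReal.ofReal (e ω w) ∂β =
      ∫⁻ w, (∫⁻ w', F (ω, w') ∂(κ ω)) * ENNReal.ofReal (e ω w) ∂β
    have hFω : Measurable fun w => F (ω, w) := by fun_prop
    have hfω : Measurable fun w => f ω w := hfm.of_uncurry_left
    have heω : Measurable fun w => ENNReal.ofReal (e ω w) :=
      hem'.comp (f := fun w => (w, ω)) (by fun_prop)
    rw [lintegral_const_mul _ heω, hZ, Kernel.withDensity_apply _ hfm, Kernel.const_apply,
      lintegral_withDensity_eq_lintegral_mul _ hfω hFω, ← lintegral_mul_const _ (hfω.mul hFω)]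
    refine lintegral_congr fun w => ?_
    simp only [Pi.mul_apply, f]
    rw [mul_right_comm, ← ENNReal.ofReal_mul (div_nonneg (Real.exp_pos _).le (hZpos ω).le),
      div_mul_cancel₀ _ (hZpos ω).ne', mul_comm]
  have := condDistrib_ae_eq_of_measure_eq_compProd (μ := jointLaw M lam D alg t) Prod.snd
    (Y := Prod.fst) (by fun_prop) hjoint
  filter_upwards [this] with ω hω
  rw [posteriorAt, hω, hκt, offPosterior_tilted_eq M hlam]

end Joint

end

/-! ### Lipschitz dependence of values on the parameter, and the information ratio of Thompson
sampling. -/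

section

variable {S A Z Z' : Type*} [MeasurableSpace S] [MeasurableSpace A] [MeasurableSpace Z]
  [MeasurableSpace Z'] {H d : ℕ}

/-! ### Values -/

lemma measurable_link (M : Model S A H d) : Measurable M.link :=
  M.lipschitz_link.continuous.measurable

lemma abs_link_le (M : Model S A H d) (x : ℝ) : |M.link x| ≤ |M.link 0| + |x| := by
  have := M.lipschitz_link.dist_le_mul x 0
  simp only [Real.dist_eq, NNReal.coe_one, one_mul, sub_zero] at this
  calc |M.link x| = |M.link 0 + (M.link x - M.link 0)| := by ring_nf
    _ ≤ |M.link 0| + |M.link x - M.link 0| := abs_add_le _ _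
    _ ≤ _ := by linarith

lemma abs_link_sub_le (M : Model S A H d) (x y : ℝ) : |M.link x - M.link y| ≤ |x - y| := by
  have := M.lipschitz_link.dist_le_mul x y
  simpa [Real.dist_eq] using this

/-- A bound on the values under the parameter `w`. -/
def valueBound (M : Model S A H d) (w : Param H d) : ℝ := ∑ h, (|M.link 0| + ‖w h‖)

lemma abs_sum_link_le (M : Model S A H d) (w : Param H d) (τ : Traj S A H) :
    |∑ h, M.link (inner ℝ (featAt M τ h) (w h))| ≤ valueBound M w := by
  refine (Finset.abs_sum_le_sum_abs _ _).trans (Finset.sum_le_sum fun h _ => ?_)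
  refine (abs_link_le M _).trans ?_
  have h1 := abs_real_inner_le_norm (featAt M τ h) (w h)
  have h2 := mul_le_mul_of_nonneg_right (norm_featAt_le M τ h) (norm_nonneg (w h))
  linarith

@[fun_prop]
lemma measurable_sum_link (M : Model S A H d) :
    Measurable fun p : Param H d × Traj S A H =>
      ∑ h, M.link (inner ℝ (featAt M p.2 h) (p.1 h)) := by
  have := measurable_link M
  fun_prop

lemma measurable_value (M : Model S A H d) (π : CtxPolicy Z S A H) :
    Measurable fun q : (Param H d × Z) × S => value M π q.1.2 q.1.1 q.2 := by
  have h : StronglyMeasurable fun p : ((Param H d × Z) × S) × Traj S A H =>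
      ∑ h, M.link (inner ℝ (featAt M p.2 h) (p.1.1.1 h)) :=
    ((measurable_sum_link M).comp (f := fun p : ((Param H d × Z) × S) × Traj S A H =>
      (p.1.1.1, p.2)) (by fun_prop)).stronglyMeasurable
  exact (h.integral_kernel_prod_right' (κ := rollout M π H le_rfl)).measurable

lemma abs_value_le (M : Model S A H d) (π : CtxPolicy Z S A H) (z : Z) (w : Param H d) (s : S) :
    |value M π z w s| ≤ valueBound M w := by
  have := norm_integral_le_of_norm_le_const (μ := rollout M π H le_rfl ((w, z), s))
    (f := fun τ => ∑ h, M.link (inner ℝ (featAt M τ h) (w h))) (C := valueBound M w)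
    (Filter.Eventually.of_forall fun τ => abs_sum_link_le M w τ)
  simpa [value] using this

lemma value_comap (M : Model S A H d) (π : CtxPolicy Z S A H) (f : Z' → Z) (hf : Measurable f)
    (z : Z') (w : Param H d) (s : S) : value M (π.comap f hf) z w s = value M π (f z) w s := by
  rw [value, rollout_comap, value]

/-- The values of one policy under two parameters differ at most by the expected difference of the
linear predictors. -/
lemma ofReal_abs_value_sub_le (M : Model S A H d) (π : CtxPolicy Z S A H) (z : Z)
    (w w' : Param H d) (s : S) :
    ENNReal.ofReal |value M π z w s - value M π z w' s| ≤
      ∫⁻ τ, ENNReal.ofReal (∑ h, |inner ℝ (featAt M τ h) (w h - w' h)|)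
        ∂(rollout M π H le_rfl ((0, z), s)) := by
  have hf := M.measurable_feat
  have hl := measurable_link M
  have hmap : ∀ u, (rollout M π H le_rfl ((u, z), s)).map eraseObs =
      (rollout M π H le_rfl ((0, z), s)).map eraseObs := by
    intro u
    refine Measure.ext_of_lintegral _ fun F hF => ?_
    rw [lintegral_map hF measurable_eraseObs, lintegral_map hF measurable_eraseObs]
    exact lintegral_rollout_eraseObs M π H le_rfl u 0 z s hF
  -- Mean rewards depend only on states and actions, so the values under both parameters are
  -- integrals against one trajectory law and can be compared pointwise.
  have hval : ∀ u, value M π z u s = ∫ τ, ∑ h, M.link (inner ℝ (featAt M τ h) (u h))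
      ∂(rollout M π H le_rfl ((0, z), s)) := by
    intro u
    have hm : StronglyMeasurable fun q : (Fin H → S × A) × S =>
        ∑ h, M.link (inner ℝ (M.feat (q.1 h)) (u h)) := by
      refine Measurable.stronglyMeasurable ?_
      fun_prop
    have h1 := integral_map (μ := rollout M π H le_rfl ((u, z), s)) (φ := eraseObs)
      (by fun_prop) hm.aestronglyMeasurable
    have h2 := integral_map (μ := rollout M π H le_rfl ((0, z), s)) (φ := eraseObs)
      (by fun_prop) hm.aestronglyMeasurable
    rw [hmap u] at h1
    exact h1.symm.trans h2
  have hint : ∀ u : Param H d, Integrable (fun τ => ∑ h, M.link (inner ℝ (featAt M τ h) (u h)))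
      (rollout M π H le_rfl ((0, z), s)) := by
    intro u
    refine Integrable.of_bound (C := valueBound M u) ?_
      (Filter.Eventually.of_forall fun τ => abs_sum_link_le M u τ)
    exact ((measurable_sum_link M).comp (f := fun τ => (u, τ)) (by fun_prop)).aestronglyMeasurable
  rw [hval, hval, ← integral_sub (hint w) (hint w'), ← Real.enorm_eq_ofReal_abs]
  refine (enorm_integral_le_lintegral_enorm _).trans (lintegral_mono fun τ => ?_)
  rw [Real.enorm_eq_ofReal_abs, ← Finset.sum_sub_distrib]
  refine ENNReal.ofReal_le_ofReal ((Finset.abs_sum_le_sum_abs _ _).trans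
    (Finset.sum_le_sum fun h _ => ?_))
  rw [inner_sub_right]
  exact abs_link_sub_le M _ _

/-! ### Thompson sampling -/

/-- Recovers the product form of Cauchy–Schwarz from the additive one: c = a/x is the choice when x
> 0; when x = 0, a large c contradicts a > 0. -/
lemma sq_le_mul_of_forall_le {a x y : ℝ} (ha : 0 ≤ a) (hx : 0 ≤ x) (hy : 0 ≤ y)
    (h : ∀ c : ℝ, 0 < c → a ≤ c / 2 * x + 1 / (2 * c) * y) : a ^ 2 ≤ x * y := by
  rcases ha.eq_or_lt with rfl | ha
  · simpa using mul_nonneg hx hy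
  rcases hx.eq_or_lt with rfl | hx
  · exfalso
    have h1 := h ((y + 1) / a) (by positivity)
    have h2 : 1 / (2 * ((y + 1) / a)) * y = a * y / (2 * (y + 1)) := by field_simp
    rw [mul_zero, zero_add, h2, le_div_iff₀ (by positivity)] at h1
    nlinarith [mul_nonneg ha.le hy]
  · have h1 := h (a / x) (by positivity)
    have h2 : a / x / 2 * x + 1 / (2 * (a / x)) * y = (a ^ 2 + x * y) / (2 * a) := by field_simp
    rw [h2, le_div_iff₀ (by positivity)] at h1
    nlinarith

/-- Bernoulli's inequality 2^x ≤ 1 + x for exponents in [0,1]. This is the origin of the log 2 in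
the final constant. -/
lemma mul_log_two_le {x : ℝ} (h0 : 0 ≤ x) (h1 : x ≤ 1) : x * Real.log 2 ≤ Real.log (1 + x) := by
  have h := rpow_one_add_le_one_add_mul_self (s := 1) (p := x) (by norm_num) h0 h1
  rw [mul_one, one_add_one_eq_two] at h
  rw [← Real.log_rpow two_pos]
  exact Real.log_le_log (by positivity) h

lemma integrable_valueBound (M : Model S A H d) (Λ : Fin H → Matrix (Fin d) (Fin d) ℝ)
    (b : Param H d) : Integrable (valueBound M) (paramGaussian Λ b) := by
  refine integrable_finsetSum _ fun h _ => (integrable_const _).add ?_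
  have hG : IsGaussian (precGaussian (Λ h) (b h)) := by unfold precGaussian; infer_instance
  have h1 : Integrable (fun u : EuclideanSpace ℝ (Fin d) => ‖u‖) (precGaussian (Λ h) (b h)) :=
    (IsGaussian.integrable_id (μ := precGaussian (Λ h) (b h))).norm
  exact (measurePreserving_eval (fun h => precGaussian (Λ h) (b h)) h).integrable_comp_of_integrable
    h1

lemma lintegral_sum_quadForm_sub {Λ : Fin H → Matrix (Fin d) (Fin d) ℝ}
    (hΛ : ∀ h, (Λ h).PosDef) (b : Param H d) :
    ∫⁻ p, ENNReal.ofReal (∑ h, quadForm (Λ h) (p.1 h - p.2 h))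
      ∂((paramGaussian Λ b).prod (paramGaussian Λ b)) = ENNReal.ofReal (2 * (H * d)) := by
  simp only [ENNReal.ofReal_sum_of_nonneg fun h _ => quadForm_nonneg (hΛ h).posSemidef _]
  rw [lintegral_finsetSum _ fun h _ => by fun_prop]
  have e : ∀ h : Fin H, ∫⁻ p, ENNReal.ofReal (quadForm (Λ h) (p.1 h - p.2 h))
      ∂((paramGaussian Λ b).prod (paramGaussian Λ b)) = ENNReal.ofReal (2 * d) := by
    intro h
    have hp := measurePreserving_eval (fun h => precGaussian (Λ h) (b h)) h
    have h1 := lintegral_quadForm_sub_precGaussian (hΛ h) (b h)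
    rw [← (hp.prod hp).map_eq, lintegral_map (by fun_prop) (by fun_prop)] at h1
    rw [Fintype.card_fin] at h1
    exact h1
  simp only [e, Finset.sum_const, Finset.card_univ, Fintype.card_fin, nsmul_eq_mul]
  rw [← ENNReal.ofReal_natCast, ← ENNReal.ofReal_mul (by positivity)]
  congr 1
  ring

section Thompson

variable (M : Model S A H d) (πs : CtxPolicy (Param H d) S A H) (β : Measure (Param H d))
  [IsProbabilityMeasure β]

/-- The regret of Thompson sampling: playing the policy attached to an independent copy of the
parameter. -/
lemma regret_comap_eq (hβ : Integrable (valueBound M) β) (f : I → Param H d) (hf : Measurable f)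
    (hfβ : (volume : Measure I).map f = β) :
    regret M πs β (πs.comap f hf) =
      ∫ p, ∫ s, (value M πs p.1 p.1 s - value M πs p.1 p.2 s) ∂M.init ∂(β.prod β) := by
  have hV := measurable_value M πs
  have hVi : ∀ w' w, Integrable (fun s => value M πs w' w s) M.init := fun w' w =>
    Integrable.of_bound (C := valueBound M w) (hV.comp (f := fun s => ((w, w'), s))
      (by fun_prop)).aestronglyMeasurable
      (Filter.Eventually.of_forall fun s => abs_value_le M πs w' w s)
  let U : Param H d → Param H d → ℝ := fun w' w => ∫ s, value M πs w' w s ∂M.init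
  have hUm : Measurable fun p : Param H d × Param H d => U p.1 p.2 := by
    have : StronglyMeasurable fun q : (Param H d × Param H d) × S => value M πs q.1.1 q.1.2 q.2 :=
      (hV.comp (f := fun q : (Param H d × Param H d) × S => ((q.1.2, q.1.1), q.2))
        (by fun_prop)).stronglyMeasurable
    exact this.integral_prod_right'.measurable
  have hUb : ∀ w' w, ‖U w' w‖ ≤ valueBound M w := fun w' w => by
    have := norm_integral_le_of_norm_le_const (μ := M.init)
      (f := fun s => value M πs w' w s) (C := valueBound M w)
      (Filter.Eventually.of_forall fun s => abs_value_le M πs w' w s)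
    simpa [U] using this
  have hUi : Integrable (fun p : Param H d × Param H d => U p.1 p.2) (β.prod β) :=
    (hβ.comp_snd β).mono' hUm.aestronglyMeasurable (Filter.Eventually.of_forall fun p => hUb _ _)
  have hUd : Integrable (fun w => U w w) β :=
    hβ.mono' (hUm.comp (f := fun w => (w, w)) (by fun_prop)).aestronglyMeasurable
      (Filter.Eventually.of_forall fun p => hUb _ _)
  have hinner : ∀ w, ∫ s, (value M πs w w s - ∫ u : I, value M (πs.comap f hf) u w s) ∂M.init =
      U w w - ∫ w', U w' w ∂β := by
    intro w
    have h1 : ∀ s, ∫ u : I, value M (πs.comap f hf) u w s = ∫ w', value M πs w' w s ∂β := by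
      intro s
      simp only [value_comap]
      rw [← hfβ, integral_map hf.aemeasurable]
      exact (hV.comp (f := fun w' => ((w, w'), s)) (by fun_prop)).aestronglyMeasurable
    have h2 : Integrable (Function.uncurry fun s w' => value M πs w' w s) (M.init.prod β) :=
      Integrable.of_bound (C := valueBound M w)
        (hV.comp (f := fun q : S × Param H d => ((w, q.2), q.1)) (by fun_prop)).aestronglyMeasurable
        (Filter.Eventually.of_forall fun q => abs_value_le M πs q.2 w q.1)
    have h3 : Integrable (fun s => ∫ w', value M πs w' w s ∂β) M.init := h2.integral_prod_left
    simp only [h1]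
    rw [integral_sub (hVi w w) h3, integral_integral_swap h2]
  rw [regret]
  simp only [hinner]
  -- Both copies have law β, so the optimal value may be evaluated at the copy that selects the
  -- policy. The same policy then appears in both values and only the parameter differs.
  rw [integral_sub hUd hUi.integral_prod_right, ← integral_prod_symm _ hUi]
  have e : ∀ p : Param H d × Param H d,
      ∫ s, (value M πs p.1 p.1 s - value M πs p.1 p.2 s) ∂M.init = U p.1 p.1 - U p.1 p.2 :=
    fun p => integral_sub (hVi _ _) (hVi _ _)
  simp only [e]
  rw [integral_sub (hUd.comp_fst β) hUi, integral_fun_fst (fun w => U w w)]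
  simp

end Thompson

/-- Thompson sampling has a small information ratio. -/
lemma exists_randClosure_regret_sq_le (M : Model S A H d) (πs : CtxPolicy (Param H d) S A H)
    {C : Set (MarkovPolicy S A H)} (hC : ∀ w, πs.at w ∈ C)
    {Λ : Fin H → Matrix (Fin d) (Fin d) ℝ} (hΛ : ∀ h, (Λ h).PosDef)
    (hq : ∀ h x, ‖x‖ ≤ 1 → quadForm (Λ h)⁻¹ x ≤ 1) (b : Param H d) :
    ∃ π ∈ randClosure C, ENNReal.ofReal (regret M πs (paramGaussian Λ b) π ^ 2) ≤
      ENNReal.ofReal (4 * (H * d) / Real.log 2) * infoGain M (paramGaussian Λ b) π := by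
  set β := paramGaussian Λ b with hβ
  -- A posterior sample as a measurable function of the uniform seed: this makes Thompson sampling
  -- an episode-level mixture of the policies π*_w.
  obtain ⟨f, hf, hfβ⟩ := Measure.exists_measurable_map_eq β
  have hlog : 0 < Real.log 2 := Real.log_pos one_lt_two
  refine ⟨πs.comap f hf, fun u => ?_, ?_⟩
  · have : (πs.comap f hf).at u = πs.at (f u) := rfl
    rw [this]
    exact hC _
  set π := πs.comap f hf with hπ
  let X : Traj S A H → ℝ := fun τ => ∑ h, quadForm (Λ h)⁻¹ (featAt M τ h)
  have hXm : Measurable X := by simp only [X]; fun_prop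
  have hX0 : ∀ τ, 0 ≤ X τ := fun τ =>
    Finset.sum_nonneg fun h _ => quadForm_nonneg (hΛ h).inv.posSemidef _
  -- The expected sum of predictive variances; the parameter 0 is as good as any other, as the
  -- features have the same law under all of them.
  let EX : ℝ≥0∞ := ∫⁻ τ, ENNReal.ofReal (X τ) ∂(randEpisode M π 0)
  have hEXtop : EX ≠ ∞ := by
    refine ne_top_of_le_ne_top (b := ENNReal.ofReal H) ENNReal.ofReal_ne_top ?_
    have : ∀ τ, ENNReal.ofReal (X τ) ≤ ENNReal.ofReal H := fun τ => by
      refine ENNReal.ofReal_le_ofReal ((Finset.sum_le_sum fun h _ =>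
        hq h _ (norm_featAt_le M τ h)).trans ?_)
      simp
    refine (lintegral_mono this).trans ?_
    simp
  have hEX : EX = ∫⁻ w, ∫⁻ s, ∫⁻ τ, ENNReal.ofReal (X τ) ∂(rollout M πs H le_rfl ((0, w), s))
      ∂M.init ∂β := by
    simp only [EX]
    rw [lintegral_randEpisode _ _ _ (by fun_prop), ← hfβ, lintegral_map _ hf]
    · simp only [hπ, rollout_comap]
    · have h1 : Measurable fun q : Param H d × S =>
          ∫⁻ τ, ENNReal.ofReal (X τ) ∂(rollout M πs H le_rfl ((0, q.1), q.2)) :=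
        (Measurable.lintegral_kernel (κ := rollout M πs H le_rfl)
          (f := fun τ => ENNReal.ofReal (X τ)) (by fun_prop)).comp
          (f := fun q : Param H d × S => (((0 : Param H d), q.1), q.2)) (by fun_prop)
      exact h1.lintegral_prod_right'
  have hinfo : ENNReal.ofReal (Real.log 2 / 2) * EX ≤ infoGain M β π := by
    rw [hβ, infoGain_paramGaussian M π hΛ b hq, ← lintegral_const_mul _ (by fun_prop)]
    refine lintegral_mono fun τ => ?_
    rw [← ENNReal.ofReal_mul (by positivity)]
    refine ENNReal.ofReal_le_ofReal ?_
    simp only [X, gainAt, Finset.mul_sum]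
    refine Finset.sum_le_sum fun h _ => ?_
    have := mul_log_two_le (quadForm_nonneg (hΛ h).inv.posSemidef (featAt M τ h))
      (hq h _ (norm_featAt_le M τ h))
    linarith
  -- The features come from the policy of `p.1` and are correlated with `p.1 - p.2`. Young's
  -- inequality is applied pointwise, so each term can be averaged on its own; the second averages
  -- to 2Hd.
  have hbound : ∀ c : ℝ, 0 < c → |regret M πs β π| ≤
      c / 2 * EX.toReal + 1 / (2 * c) * (2 * (H * d)) := by
    intro c hc
    have hreg : ENNReal.ofReal |regret M πs β π| ≤
        ENNReal.ofReal (c / 2) * EX + ENNReal.ofReal (1 / (2 * c)) *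
          ENNReal.ofReal (2 * (H * d)) := by
      rw [hπ, regret_comap_eq M πs β (integrable_valueBound M Λ b) f hf hfβ,
        ← Real.enorm_eq_ofReal_abs]
      have hpt : ∀ (p : Param H d × Param H d) (s : S),
          ‖value M πs p.1 p.1 s - value M πs p.1 p.2 s‖ₑ ≤
          ENNReal.ofReal (c / 2) *
            ∫⁻ τ, ENNReal.ofReal (X τ) ∂(rollout M πs H le_rfl ((0, p.1), s)) +
          ENNReal.ofReal (1 / (2 * c)) *
            ENNReal.ofReal (∑ h, quadForm (Λ h) (p.1 h - p.2 h)) := by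
        intro p s
        rw [Real.enorm_eq_ofReal_abs]
        refine (ofReal_abs_value_sub_le M πs p.1 p.1 p.2 s).trans ?_
        have hpt2 : ∀ τ, ENNReal.ofReal (∑ h, |inner ℝ (featAt M τ h) (p.1 h - p.2 h)|) ≤
            ENNReal.ofReal (c / 2) * ENNReal.ofReal (X τ) + ENNReal.ofReal (1 / (2 * c)) *
              ENNReal.ofReal (∑ h, quadForm (Λ h) (p.1 h - p.2 h)) := by
          intro τ
          have hY : 0 ≤ ∑ h, quadForm (Λ h) (p.1 h - p.2 h) :=
            Finset.sum_nonneg fun h _ => quadForm_nonneg (hΛ h).posSemidef _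
          rw [← ENNReal.ofReal_mul (by positivity), ← ENNReal.ofReal_mul (by positivity),
            ← ENNReal.ofReal_add (mul_nonneg (by positivity) (hX0 τ))
              (mul_nonneg (by positivity) hY)]
          refine ENNReal.ofReal_le_ofReal ?_
          simp only [X, Finset.mul_sum, ← Finset.sum_add_distrib]
          exact Finset.sum_le_sum fun h _ => abs_inner_le_quadForm (hΛ h) _ _ hc
        refine (lintegral_mono hpt2).trans (le_of_eq ?_)
        rw [lintegral_add_right _ (by fun_prop), lintegral_const_mul _ (by fun_prop)]
        simp
      refine (enorm_integral_le_lintegral_enorm _).trans ?_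
      have hrm : Measurable fun q : Param H d × S =>
          ∫⁻ τ, ENNReal.ofReal (X τ) ∂(rollout M πs H le_rfl ((0, q.1), q.2)) :=
        (Measurable.lintegral_kernel (κ := rollout M πs H le_rfl)
          (f := fun τ => ENNReal.ofReal (X τ)) (by fun_prop)).comp
          (f := fun q : Param H d × S => (((0 : Param H d), q.1), q.2)) (by fun_prop)
      have hpt3 : ∀ p : Param H d × Param H d,
          ‖∫ s, (value M πs p.1 p.1 s - value M πs p.1 p.2 s) ∂M.init‖ₑ ≤
          ENNReal.ofReal (c / 2) *
            (∫⁻ s, ∫⁻ τ, ENNReal.ofReal (X τ) ∂(rollout M πs H le_rfl ((0, p.1), s)) ∂M.init) +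
          ENNReal.ofReal (1 / (2 * c)) *
            ENNReal.ofReal (∑ h, quadForm (Λ h) (p.1 h - p.2 h)) := by
        intro p
        refine (enorm_integral_le_lintegral_enorm _).trans
          ((lintegral_mono (hpt p)).trans (le_of_eq ?_))
        rw [lintegral_add_right _ (by fun_prop), lintegral_const_mul' _ _ ENNReal.ofReal_ne_top]
        simp
      refine (lintegral_mono hpt3).trans (le_of_eq ?_)
      rw [lintegral_add_right _ (by fun_prop), lintegral_const_mul' _ _ ENNReal.ofReal_ne_top,
        lintegral_const_mul' _ _ ENNReal.ofReal_ne_top, lintegral_sum_quadForm_sub hΛ b, hEX]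
      have hsm : Measurable fun w : Param H d => ∫⁻ s, ∫⁻ τ, ENNReal.ofReal (X τ)
          ∂(rollout M πs H le_rfl ((0, w), s)) ∂M.init := hrm.lintegral_prod_right'
      rw [lintegral_prod (fun p : Param H d × Param H d => ∫⁻ s, ∫⁻ τ, ENNReal.ofReal (X τ)
          ∂(rollout M πs H le_rfl ((0, p.1), s)) ∂M.init) (hsm.comp measurable_fst).aemeasurable]
      simp
    have h2 := ENNReal.toReal_mono (by finiteness) hreg
    rw [ENNReal.toReal_ofReal (abs_nonneg _), ENNReal.toReal_add (by finiteness) (by finiteness),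
      ENNReal.toReal_mul, ENNReal.toReal_mul, ENNReal.toReal_ofReal (by positivity),
      ENNReal.toReal_ofReal (by positivity), ENNReal.toReal_ofReal (by positivity)] at h2
    exact h2
  have hsq := sq_le_mul_of_forall_le (abs_nonneg _) ENNReal.toReal_nonneg
    (by positivity : (0 : ℝ) ≤ 2 * (H * d)) hbound
  rw [sq_abs] at hsq
  calc ENNReal.ofReal (regret M πs β π ^ 2)
      ≤ ENNReal.ofReal (EX.toReal * (2 * (H * d))) := ENNReal.ofReal_le_ofReal hsq
    _ = ENNReal.ofReal (4 * (H * d) / Real.log 2) * (ENNReal.ofReal (Real.log 2 / 2) * EX) := by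
        have : 4 * ((H : ℝ) * d) / Real.log 2 * (Real.log 2 / 2) = 2 * (H * d) := by
          field_simp
          ring
        rw [← mul_assoc (ENNReal.ofReal _) (ENNReal.ofReal _) EX,
          ← ENNReal.ofReal_mul (by positivity), this, ENNReal.ofReal_mul ENNReal.toReal_nonneg,
          ENNReal.ofReal_toReal hEXtop, mul_comm]
    _ ≤ _ := by gcongr

end

/-! ### Determinants, eigenvalues, and the total information gained. -/

section

section Matrices

variable {ι : Type*} [Fintype ι] [DecidableEq ι]

/-- The matrix determinant lemma; it makes the per-episode gains telescope into a log-determinant.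
-/
lemma det_add_vecMulVec {Λ : Matrix ι ι ℝ} (hΛ : Λ.PosDef) (x : EuclideanSpace ℝ ι) :
    (Λ + vecMulVec (fun j => x j) (fun j => x j)).det = Λ.det * (1 + quadForm Λ⁻¹ x) := by
  rw [vecMulVec_eq Unit, det_add_replicateCol_mul_replicateRow hΛ.det_pos.ne'.isUnit,
    det_unique (n := Unit) (1 + _)]
  congr 1
  simp only [Matrix.add_apply, one_apply_eq, quadForm, add_right_inj]
  simp only [mul_apply, replicateRow_apply, replicateCol_apply, dotProduct, mulVec, Finset.sum_mul,
    Finset.mul_sum]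
  rw [Finset.sum_comm]
  exact Finset.sum_congr rfl fun i _ => Finset.sum_congr rfl fun j _ => by ring

/-- AM-GM for the eigenvalues, by bounding log with its tangent at their mean m. -/
lemma log_det_le {K : Matrix ι ι ℝ} (hK : K.PosDef) [Nonempty ι] :
    Real.log K.det ≤ Fintype.card ι * Real.log (K.trace / Fintype.card ι) := by
  have hn : (0 : ℝ) < Fintype.card ι := by exact_mod_cast Fintype.card_pos
  have hev := hK.eigenvalues_pos
  have htr : K.trace = ∑ i, hK.isHermitian.eigenvalues i := by
    simpa using hK.isHermitian.trace_eq_sum_eigenvalues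
  have hdet : K.det = ∏ i, hK.isHermitian.eigenvalues i := by
    simpa using hK.isHermitian.det_eq_prod_eigenvalues
  have hm : 0 < K.trace / Fintype.card ι := by
    rw [htr]
    exact div_pos (Finset.sum_pos (fun i _ => hev i) Finset.univ_nonempty) hn
  set m := K.trace / Fintype.card ι with hmdef
  rw [hdet, Real.log_prod fun i _ => (hev i).ne']
  have h1 : ∀ i, Real.log (hK.isHermitian.eigenvalues i) ≤
      Real.log m + (hK.isHermitian.eigenvalues i / m - 1) := by
    intro i
    have := Real.log_le_sub_one_of_pos (div_pos (hev i) hm)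
    rw [Real.log_div (hev i).ne' hm.ne'] at this
    linarith
  refine (Finset.sum_le_sum fun i _ => h1 i).trans (le_of_eq ?_)
  rw [Finset.sum_add_distrib, Finset.sum_sub_distrib, ← Finset.sum_div, ← htr, Finset.sum_const,
    Finset.sum_const, Finset.card_univ, nsmul_eq_mul, nsmul_eq_mul, mul_one]
  have : K.trace / m = Fintype.card ι := by
    have h2 : K.trace = m * Fintype.card ι := by rw [hmdef]; field_simp
    rw [h2]; field_simp
  rw [this]
  ring

/-- The symmetric inverse square root of a positive definite matrix. -/
lemma sqrt_inv_mul_sqrt_inv {Λ : Matrix ι ι ℝ} (hΛ : Λ.PosDef) :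
    (CFC.sqrt Λ)⁻¹ * (CFC.sqrt Λ)⁻¹ = Λ⁻¹ ∧ (CFC.sqrt Λ)⁻¹.IsHermitian ∧
      IsUnit (CFC.sqrt Λ)⁻¹ := by
  have hBB : CFC.sqrt Λ * CFC.sqrt Λ = Λ := CFC.sqrt_mul_sqrt_self _ hΛ.posSemidef.nonneg
  have hBH : (CFC.sqrt Λ).IsHermitian := (CFC.sqrt_nonneg Λ).isSelfAdjoint
  have hdet : IsUnit (CFC.sqrt Λ).det := by
    refine isUnit_iff_ne_zero.2 fun h => hΛ.det_pos.ne' ?_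
    rw [← hBB, det_mul, h, zero_mul]
  refine ⟨by rw [← Matrix.mul_inv_rev, hBB], hBH.inv, ?_⟩
  rw [isUnit_iff_isUnit_det]
  exact isUnit_nonsing_inv_det _ hdet

/-- Conjugating Λ + P by Λ^{-1/2} gives a matrix whose determinant is the ratio and whose trace is
the dimension plus tr(Λ⁻¹P). -/
lemma log_det_add_div_le {Λ P : Matrix ι ι ℝ} (hΛ : Λ.PosDef) (hP : P.PosSemidef) [Nonempty ι] :
    Real.log ((Λ + P).det / Λ.det) ≤
      Fintype.card ι * Real.log (1 + (Λ⁻¹ * P).trace / Fintype.card ι) := by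
  have hn : (0 : ℝ) < Fintype.card ι := by exact_mod_cast Fintype.card_pos
  obtain ⟨hBB, hBH, hBu⟩ := sqrt_inv_mul_sqrt_inv hΛ
  set B := (CFC.sqrt Λ)⁻¹
  have hK : (B * (Λ + P) * B).PosDef := by
    have h1 := (hΛ.add_posSemidef hP).conjTranspose_mul_mul_same (B := B)
      (mulVec_injective_of_isUnit hBu)
    rwa [hBH.eq] at h1
  have hdet : (B * (Λ + P) * B).det = (Λ + P).det / Λ.det := by
    have h1 : B.det * B.det = Λ.det⁻¹ := by rw [← det_mul, hBB, det_nonsing_inv, Ring.inverse_eq_inv']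
    rw [det_mul, det_mul, mul_right_comm, h1, inv_mul_eq_div]
  have htr : (B * (Λ + P) * B).trace = Fintype.card ι + (Λ⁻¹ * P).trace := by
    rw [trace_mul_cycle, hBB, mul_add, nonsing_inv_mul _ hΛ.det_pos.ne'.isUnit, trace_add, trace_one]
  have h2 := log_det_le hK
  rw [hdet, htr, add_div, div_self hn.ne'] at h2
  exact h2

lemma trace_mul_sum_vecMulVec {κ : Type*} (s : Finset κ) (Q : Matrix ι ι ℝ)
    (x : κ → EuclideanSpace ℝ ι) :
    (Q * ∑ i ∈ s, vecMulVec (fun j => x i j) (fun j => x i j)).trace =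
      ∑ i ∈ s, quadForm Q (x i) := by
  rw [Finset.mul_sum, trace_sum]
  refine Finset.sum_congr rfl fun i _ => ?_
  rw [mul_vecMulVec, trace_vecMulVec, dotProduct_comm]
  rfl

end Matrices

section Eigenvalues

variable {d : ℕ}

/-- For d ≥ 1 the spectrum is nonempty and finite, so its infimum is an eigenvalue and not the
default value 0. -/
lemma lambdaMin_pos {B : Matrix (Fin d) (Fin d) ℝ} (hB : B.PosDef) (hd : 1 ≤ d) :
    0 < lambdaMin B := by
  have : Nonempty (Fin d) := ⟨⟨0, hd⟩⟩
  have hs : spectrum ℝ B = Set.range hB.isHermitian.eigenvalues :=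
    hB.isHermitian.spectrum_real_eq_range_eigenvalues
  have hmem : sInf (spectrum ℝ B) ∈ spectrum ℝ B := by
    rw [hs]
    exact (Set.range_nonempty _).csInf_mem (Set.finite_range _)
  have h2 : lambdaMin B ∈ Set.range hB.isHermitian.eigenvalues := hs ▸ hmem
  obtain ⟨i, hi⟩ := h2
  rw [← hi]
  exact hB.eigenvalues_pos i

lemma lambdaMin_mul_le {B : Matrix (Fin d) (Fin d) ℝ} (hB : B.IsHermitian)
    (u : EuclideanSpace ℝ (Fin d)) : lambdaMin B * ‖u‖ ^ 2 ≤ quadForm B u := by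
  have h1 : algebraMap ℝ (Matrix (Fin d) (Fin d) ℝ) (lambdaMin B) ≤ B := by
    refine algebraMap_le_of_le_spectrum (fun x hx => csInf_le ?_ hx) hB
    rw [hB.spectrum_real_eq_range_eigenvalues]
    exact (Set.finite_range _).bddBelow
  have h2 : (B - algebraMap ℝ (Matrix (Fin d) (Fin d) ℝ) (lambdaMin B)).PosSemidef := h1
  have h3 := quadForm_nonneg h2 u
  have h4 : quadForm (B - algebraMap ℝ (Matrix (Fin d) (Fin d) ℝ) (lambdaMin B)) u =
      quadForm B u - lambdaMin B * ‖u‖ ^ 2 := by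
    rw [quadForm, sub_mulVec, dotProduct_sub, Algebra.algebraMap_eq_smul_one, smul_mulVec,
      one_mulVec, dotProduct_smul, dotProduct_ofLp u u, real_inner_self_eq_norm_sq, smul_eq_mul]
    rfl
  linarith

lemma trace_le_mul_lambdaMax {B : Matrix (Fin d) (Fin d) ℝ} (hB : B.IsHermitian) :
    B.trace ≤ d * lambdaMax B := by
  have htr : B.trace = ∑ i, hB.eigenvalues i := by simpa using hB.trace_eq_sum_eigenvalues
  have hbdd : BddAbove (spectrum ℝ B) := by
    rw [hB.spectrum_real_eq_range_eigenvalues]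
    exact (Set.finite_range _).bddAbove
  rw [htr]
  refine (Finset.sum_le_sum fun i _ =>
    le_csSup hbdd (hB.eigenvalues_mem_spectrum_real i)).trans (le_of_eq ?_)
  simp [lambdaMax]

end Eigenvalues

variable {S A : Type*} [MeasurableSpace S] [MeasurableSpace A] {H d : ℕ}

/-! ### The information potential -/

/-- The total information gained along a history. -/
def potential (M : Model S A H d) (lam : ℝ) (D : Dataset S A H) {t : ℕ} (ω : Hist S A H t) : ℝ :=
  ∑ h, Real.log ((histGram M lam D ω h).det / (gram M lam D h).det) / 2

section Potential

variable (M : Model S A H d) (lam : ℝ) (D : Dataset S A H)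

@[fun_prop]
lemma measurable_potential (t : ℕ) :
    Measurable fun ω : Hist S A H t => potential M lam D ω := by
  have hdet : ∀ h, Measurable fun ω : Hist S A H t => (histGram M lam D ω h).det := by
    intro h
    simp only [det_apply]
    refine Finset.measurable_fun_sum _ fun p _ => Measurable.const_smul ?_ _
    refine Finset.measurable_fun_prod _ fun i _ => ?_
    simp only [histGram, Matrix.add_apply, Matrix.sum_apply, vecMulVec_apply]
    fun_prop
  unfold potential
  fun_prop

lemma potential_zero {lam : ℝ} (hlam : 0 < lam) (ω : Hist S A H 0) : potential M lam D ω = 0 := by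
  refine Finset.sum_eq_zero fun h _ => ?_
  have : histGram M lam D ω h = gram M lam D h := by simp [histGram]
  rw [this, div_self (posDef_gram M hlam D h).det_pos.ne', Real.log_one, zero_div]

/-- Each stage has its own Gram matrix, so an episode makes exactly one rank-one update per stage.
-/
lemma potential_snoc {lam : ℝ} (hlam : 0 < lam) {t : ℕ} (ω : Hist S A H t) (τ : Traj S A H) :
    potential M lam D (Fin.snoc (α := fun _ => Traj S A H) ω τ) =
      potential M lam D ω + gainAt M (histGram M lam D ω) τ := by
  rw [potential, potential, gainAt, ← Finset.sum_add_distrib]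
  refine Finset.sum_congr rfl fun h _ => ?_
  have h1 : histGram M lam D (Fin.snoc (α := fun _ => Traj S A H) ω τ) h =
      histGram M lam D ω h + vecMulVec (fun j => featAt M τ h j) (fun j => featAt M τ h j) := by
    simp [histGram, Fin.sum_univ_castSucc, add_assoc]
  have hp := (posDef_gram M hlam D h).det_pos
  have hp' := (posDef_histGram M hlam D ω h).det_pos
  have hq := quadForm_nonneg (posDef_histGram M hlam D ω h).inv.posSemidef (featAt M τ h)
  rw [h1, det_add_vecMulVec (posDef_histGram M hlam D ω h), mul_div_right_comm,
    Real.log_mul (div_pos hp' hp).ne' (by positivity)]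
  ring

lemma potential_nonneg {lam : ℝ} (hlam : 0 < lam) {t : ℕ} (ω : Hist S A H t) :
    0 ≤ potential M lam D ω := by
  induction t with
  | zero => rw [potential_zero M D hlam]
  | succ t ih =>
    rw [← Fin.snoc_init_self ω, potential_snoc M D hlam]
    exact add_nonneg (ih _) (gainAt_nonneg M (posDef_histGram M hlam D _) _)

/-- The information gained in episode `t` after the history `ω`. -/
def episodeGain (alg : Algorithm S A H) (t : ℕ) (ω : Hist S A H t) : ℝ≥0∞ :=
  ∫⁻ τ, ENNReal.ofReal (gainAt M (histGram M lam D ω) τ) ∂(randEpisode M (playedPolicy alg t ω) 0)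

variable (alg : Algorithm S A H)

/-- The chain rule for information: the conditional mean of the increment given parameter and
history is the episode gain, which is free of the parameter. -/
lemma lintegral_potential_succ {lam : ℝ} (hlam : 0 < lam) (t : ℕ) :
    ∫⁻ ω, ENNReal.ofReal (potential M lam D ω) ∂(histLaw M lam D alg (t + 1)) =
      ∫⁻ ω, ENNReal.ofReal (potential M lam D ω) ∂(histLaw M lam D alg t) +
        ∫⁻ ω, episodeGain M lam D alg t ω ∂(histLaw M lam D alg t) := by
  have hf := M.measurable_feat
  have key : ∀ (w : Param H d) (ω : Hist S A H t),
      ∫⁻ τ, ENNReal.ofReal (potential M lam D (Fin.snoc (α := fun _ => Traj S A H) ω τ))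
        ∂(onlineKernel M alg t (w, ω)) =
      ENNReal.ofReal (potential M lam D ω) + episodeGain M lam D alg t ω := by
    intro w ω
    simp only [potential_snoc M D hlam, ENNReal.ofReal_add (potential_nonneg M D hlam ω)
      (gainAt_nonneg M (posDef_histGram M hlam D ω) _)]
    rw [lintegral_add_left (by fun_prop), lintegral_const, measure_univ, mul_one,
      onlineKernel_apply, episodeGain]
    congr 1
    exact lintegral_randEpisode_eraseObs M _ w 0 (F := fun q => ENNReal.ofReal
      (∑ h, Real.log (1 + quadForm (histGram M lam D ω h)⁻¹ (M.feat (q.1 h))) / 2)) (by fun_prop)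
  have hΨ : Measurable fun ω : Hist S A H t =>
      ENNReal.ofReal (potential M lam D ω) + episodeGain M lam D alg t ω := by
    -- Read backwards, `key` writes the sum as an integral against a kernel, which yields its
    -- measurability.
    simp only [← key 0]
    have h1 : Measurable fun x : Hist S A H t × Traj S A H =>
        ENNReal.ofReal (potential M lam D (Fin.snoc (α := fun _ => Traj S A H) x.1 x.2)) :=
      ENNReal.measurable_ofReal.comp ((measurable_potential M lam D (t + 1)).comp
        (measurable_snoc_hist t))
    exact h1.lintegral_kernel_prod_right' (κ := (onlineKernel M alg t).comap
      (fun ω : Hist S A H t => ((0 : Param H d), ω)) (by fun_prop))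
  rw [histLaw, lintegral_map (by fun_prop) measurable_snd, lintegral_jointLaw_succ _ _ _ _ _
    (F := fun p => ENNReal.ofReal (potential M lam D p.2))
    (ENNReal.measurable_ofReal.comp ((measurable_potential M lam D (t + 1)).comp measurable_snd))]
  rw [← lintegral_add_left (by fun_prop), histLaw, lintegral_map hΨ measurable_snd]
  exact lintegral_congr fun p => key p.1 p.2

lemma lintegral_potential {lam : ℝ} (hlam : 0 < lam) (T : ℕ) :
    ∫⁻ ω, ENNReal.ofReal (potential M lam D ω) ∂(histLaw M lam D alg T) =
      ∑ t ∈ Finset.range T, ∫⁻ ω, episodeGain M lam D alg t ω ∂(histLaw M lam D alg t) := by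
  induction T with
  | zero => simp [potential_zero M D hlam]
  | succ T ih => rw [lintegral_potential_succ M D alg hlam, ih, Finset.sum_range_succ]

lemma potential_le_log {lam : ℝ} (hlam : 0 < lam) (hd : 1 ≤ d) {T : ℕ} (ω : Hist S A H T) :
    potential M lam D ω ≤ ∑ h, d * Real.log
      (1 + (∑ t, quadForm (gram M lam D h)⁻¹ (featAt M (ω t) h)) / d) / 2 := by
  have : Nonempty (Fin d) := ⟨⟨0, hd⟩⟩
  refine Finset.sum_le_sum fun h _ => ?_
  have h1 := log_det_add_div_le (posDef_gram M hlam D h)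
    (posSemidef_sum Finset.univ fun i _ => posSemidef_vecMulVec (featAt M (ω i) h))
  rw [trace_mul_sum_vecMulVec, Fintype.card_fin] at h1
  rw [histGram]
  linarith

/-- Each of the T terms φᵀ Λ_{h,N}⁻¹ φ is at most 1/λ_min, since features have norm at most 1. The
bound holds for every history. -/
lemma potential_le_avgLog {lam : ℝ} (hlam : 0 < lam) (hd : 1 ≤ d) (hH : 1 ≤ H) {T : ℕ}
    (ω : Hist S A H T) :
    potential M lam D ω ≤ H * d / 2 * avgLog M lam D T := by
  have hd0 : (0 : ℝ) < d := by exact_mod_cast hd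
  have hH0 : (0 : ℝ) < H := by exact_mod_cast hH
  have e : (H * d / 2 * avgLog M lam D T : ℝ) =
      ∑ h, d * Real.log (1 + T / (d * lambdaMin (gram M lam D h))) / 2 := by
    rw [avgLog, ← Finset.sum_div, ← Finset.mul_sum]
    field_simp
  rw [e]
  refine (potential_le_log M D hlam hd ω).trans (Finset.sum_le_sum fun h _ => ?_)
  have hpd := posDef_gram M hlam D h
  have hmin := lambdaMin_pos hpd hd
  have h1 : ∑ t, quadForm (gram M lam D h)⁻¹ (featAt M (ω t) h) ≤
      T / lambdaMin (gram M lam D h) := by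
    have : ∀ t, quadForm (gram M lam D h)⁻¹ (featAt M (ω t) h) ≤
        1 / lambdaMin (gram M lam D h) := fun t => by
      refine (quadForm_inv_le hpd hmin (lambdaMin_mul_le hpd.isHermitian) _).trans ?_
      gcongr
      exact pow_le_one₀ (norm_nonneg _) (norm_featAt_le M _ _)
    refine (Finset.sum_le_sum fun t _ => this t).trans (le_of_eq ?_)
    simp [div_eq_mul_inv]
  have h0 : 0 ≤ ∑ t, quadForm (gram M lam D h)⁻¹ (featAt M (ω t) h) :=
    Finset.sum_nonneg fun t _ => quadForm_nonneg hpd.inv.posSemidef _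
  have h2 : (∑ t, quadForm (gram M lam D h)⁻¹ (featAt M (ω t) h)) / d ≤
      T / (d * lambdaMin (gram M lam D h)) := by
    rw [mul_comm, ← div_div]
    gcongr
  gcongr

/-- Giving up the logarithm makes the bound linear in the φφᵀ, so its expectation depends only on
the visitation covariance. -/
lemma potential_le_sum {lam : ℝ} (hlam : 0 < lam) (hd : 1 ≤ d) {T : ℕ} (ω : Hist S A H T) :
    potential M lam D ω ≤
      ∑ h, (∑ t, quadForm (gram M lam D h)⁻¹ (featAt M (ω t) h)) / 2 := by
  have hd0 : (0 : ℝ) < d := by exact_mod_cast hd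
  refine (potential_le_log M D hlam hd ω).trans (Finset.sum_le_sum fun h _ => ?_)
  have h0 : 0 ≤ ∑ t, quadForm (gram M lam D h)⁻¹ (featAt M (ω t) h) :=
    Finset.sum_nonneg fun t _ => quadForm_nonneg (posDef_gram M hlam D h).inv.posSemidef _
  have h1 := Real.log_le_sub_one_of_pos
    (x := 1 + (∑ t, quadForm (gram M lam D h)⁻¹ (featAt M (ω t) h)) / d) (by positivity)
  rw [add_sub_cancel_left, le_div_iff₀ hd0] at h1
  linarith

lemma integrable_featAt_mul (T : ℕ) (t : Fin T) (h : Fin H) (i j : Fin d) :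
    Integrable (fun ω : Hist S A H T => featAt M (ω t) h i * featAt M (ω t) h j)
      (histLaw M lam D alg T) := by
  have : IsProbabilityMeasure (histLaw M lam D alg T) :=
    Measure.isProbabilityMeasure_map (by fun_prop)
  refine Integrable.of_bound (C := 1) (by fun_prop) (Filter.Eventually.of_forall fun ω => ?_)
  have h1 : ∀ i, ‖featAt M (ω t) h i‖ ≤ 1 := fun i =>
    (PiLp.norm_apply_le _ _).trans (norm_featAt_le M _ _)
  rw [norm_mul]
  exact mul_le_one₀ (h1 i) (norm_nonneg _) (h1 j)

lemma integral_sum_quadForm_featAt (Q : Matrix (Fin d) (Fin d) ℝ) {T : ℕ} (hT : 1 ≤ T)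
    (h : Fin H) :
    Integrable (fun ω => ∑ t : Fin T, quadForm Q (featAt M (ω t) h)) (histLaw M lam D alg T) ∧
    ∫ ω, ∑ t : Fin T, quadForm Q (featAt M (ω t) h) ∂(histLaw M lam D alg T) =
      T * (Q * visitCov M lam D alg T h).trace := by
  have hT0 : (T : ℝ) ≠ 0 := by positivity
  have hi := integrable_featAt_mul M lam D alg T
  simp only [quadForm_eq_sum]
  have hI : ∀ t i j, Integrable (fun ω : Hist S A H T =>
      Q i j * (featAt M (ω t) h i * featAt M (ω t) h j)) (histLaw M lam D alg T) :=
    fun t i j => (hi t h i j).const_mul _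
  refine ⟨integrable_finsetSum _ fun t _ => integrable_finsetSum _ fun i _ =>
    integrable_finsetSum _ fun j _ => hI t i j, ?_⟩
  rw [integral_finsetSum _ fun t _ => integrable_finsetSum _ fun i _ =>
    integrable_finsetSum _ fun j _ => hI t i j]
  simp only [integral_finsetSum _ fun i _ => integrable_finsetSum _ fun j _ => hI _ i j,
    integral_finsetSum _ fun j _ => hI _ _ j, integral_const_mul]
  rw [Finset.sum_comm]
  simp only [trace, diag_apply, mul_apply, visitCov, of_apply, Finset.mul_sum]
  refine Finset.sum_congr rfl fun i _ => ?_
  rw [Finset.sum_comm]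
  refine Finset.sum_congr rfl fun j _ => Finset.sum_congr rfl fun t _ => ?_
  simp only [mul_comm (featAt M _ h j)]
  field_simp

/-- By cyclicity, n_h tr(Λ⁻¹Σ̄) is the trace of the whitened covariance in `stageCoverage`, and a
trace is at most d times the largest eigenvalue. -/
lemma trace_inv_mul_visitCov_le {lam : ℝ} (hlam : 0 < lam) (hD : ∀ h, 1 ≤ D.n h) (T : ℕ)
    (h : Fin H) :
    ((gram M lam D h)⁻¹ * visitCov M lam D alg T h).trace ≤
      d * (stageCoverage M lam D alg T h / D.n h) := by
  have hn : (0 : ℝ) < D.n h := by exact_mod_cast hD h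
  have hpd : ((D.n h : ℝ)⁻¹ • gram M lam D h).PosDef :=
    (posDef_gram M hlam D h).smul (inv_pos.2 hn)
  obtain ⟨hBB, hBH, -⟩ := sqrt_inv_mul_sqrt_inv hpd
  set B := (CFC.sqrt ((D.n h : ℝ)⁻¹ • gram M lam D h))⁻¹ with hB
  have hV : (visitCov M lam D alg T h).IsHermitian := by
    ext i j
    simp only [conjTranspose_apply, visitCov, of_apply, star_trivial, mul_comm (featAt M _ h j)]
  have hBV : (B * visitCov M lam D alg T h * B).IsHermitian := by
    have := isHermitian_conjTranspose_mul_mul B hV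
    rwa [hBH.eq] at this
  have hinv : ((D.n h : ℝ)⁻¹ • gram M lam D h)⁻¹ = (D.n h : ℝ) • (gram M lam D h)⁻¹ := by
    refine inv_eq_right_inv ?_
    rw [smul_mul_smul_comm, inv_mul_cancel₀ hn.ne',
      mul_nonsing_inv _ (posDef_gram M hlam D h).det_pos.ne'.isUnit, one_smul]
  have h1 := trace_le_mul_lambdaMax hBV
  rw [trace_mul_cycle, hBB, hinv, smul_mul, trace_smul, smul_eq_mul] at h1
  rw [mul_div_assoc', le_div_iff₀ hn, mul_comm]
  exact h1

lemma lintegral_potential_le_coverage {lam : ℝ} (hlam : 0 < lam) (hd : 1 ≤ d) (hH : 1 ≤ H)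
    {T : ℕ} (hT : 1 ≤ T) (hD : ∀ h, 1 ≤ D.n h) :
    ∫⁻ ω, ENNReal.ofReal (potential M lam D ω) ∂(histLaw M lam D alg T) ≤
      ENNReal.ofReal (H * d / 2 * (T * (coverage M lam D alg T / D.size))) := by
  have hH0 : (0 : ℝ) < H := by exact_mod_cast hH
  have hN : (0 : ℝ) < D.size := by
    have : 0 < D.size := Finset.sum_pos (fun h _ => hD h) ⟨⟨0, hH⟩, Finset.mem_univ _⟩
    exact_mod_cast this
  have hi := fun h => integral_sum_quadForm_featAt M lam D alg (gram M lam D h)⁻¹ hT h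
  have hsum : Integrable (fun ω : Hist S A H T =>
      ∑ h, (∑ t, quadForm (gram M lam D h)⁻¹ (featAt M (ω t) h)) / 2) (histLaw M lam D alg T) :=
    integrable_finsetSum _ fun h _ => (hi h).1.div_const _
  refine (lintegral_mono fun ω =>
    ENNReal.ofReal_le_ofReal (potential_le_sum M D hlam hd ω)).trans ?_
  rw [← ofReal_integral_eq_lintegral_ofReal hsum (Filter.Eventually.of_forall fun ω =>
    Finset.sum_nonneg fun h _ => div_nonneg (Finset.sum_nonneg fun t _ =>
      quadForm_nonneg (posDef_gram M hlam D h).inv.posSemidef _) zero_le_two)]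
  refine ENNReal.ofReal_le_ofReal ?_
  rw [integral_finsetSum _ fun h _ => (hi h).1.div_const _]
  simp only [integral_div, (hi _).2]
  -- The factors N and 1/H in the coverage cancel against the division by N and the factor H.
  have e : (H * d / 2 * (T * (coverage M lam D alg T / D.size)) : ℝ) =
      ∑ h, T * (d * (stageCoverage M lam D alg T h / D.n h)) / 2 := by
    rw [coverage, ← Finset.sum_div, ← Finset.mul_sum, ← Finset.mul_sum]
    field_simp
  rw [e]
  refine Finset.sum_le_sum fun h _ => ?_
  have := trace_inv_mul_visitCov_le M D alg hlam hD T h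
  gcongr

end Potential

end

/-! ### Regret of the information-directed rule. -/

section

variable {S A : Type*} [MeasurableSpace S] [MeasurableSpace A] {H d : ℕ}

section Regret

variable (M : Model S A H d) (lam : ℝ) (D : Dataset S A H) (πs : CtxPolicy (Param H d) S A H)
  (alg : Algorithm S A H)

lemma measurable_episodeRegret (t : ℕ) : Measurable (episodeRegret M lam D πs alg t) := by
  have h1 : StronglyMeasurable fun q : ((Hist S A H t × Param H d) × S) × I =>
      value M (alg t) (q.1.1.1, q.2) q.1.1.2 q.1.2 :=
    ((measurable_value M (alg t)).comp (f := fun q : ((Hist S A H t × Param H d) × S) × I =>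
      ((q.1.1.2, (q.1.1.1, q.2)), q.1.2)) (by fun_prop)).stronglyMeasurable
  have h2 : StronglyMeasurable fun q : (Hist S A H t × Param H d) × S =>
      value M πs q.1.2 q.1.2 q.2 :=
    ((measurable_value M πs).comp (f := fun q : (Hist S A H t × Param H d) × S =>
      ((q.1.2, q.1.2), q.2)) (by fun_prop)).stronglyMeasurable
  have h3 := (h2.sub (h1.integral_prod_right' (ν := (volume : Measure I)))).integral_prod_right' (ν := M.init)
  have : IsMarkovKernel (posteriorAt M lam D alg t) := by
    unfold posteriorAt
    infer_instance
  have h4 := (h3.integral_kernel_prod_right' (κ := posteriorAt M lam D alg t)).measurable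
  have e : episodeRegret M lam D πs alg t = fun ω => ∫ w, ∫ s, (value M πs w w s -
      ∫ u : I, value M (alg t) (ω, u) w s) ∂M.init ∂(posteriorAt M lam D alg t ω) := by
    funext ω
    simp only [episodeRegret, regret, playedPolicy, value_comap]
  rw [e]
  exact h4

/-- A minimiser of the information ratio inherits the information ratio of Thompson sampling. -/
lemma ae_episodeRegret_sq_le {lam : ℝ} (hlam : 1 ≤ lam) (hH : 1 ≤ H) (hd : 1 ≤ d)
    {C : Set (MarkovPolicy S A H)} (hC : ∀ w, πs.at w ∈ C) {T : ℕ}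
    (halg : IsIDS M lam D πs (randClosure C) 0 T alg) {t : ℕ} (ht : t < T) :
    ∀ᵐ ω ∂(histLaw M lam D alg t), ENNReal.ofReal (episodeRegret M lam D πs alg t ω ^ 2) ≤
      ENNReal.ofReal (4 * (H * d) / Real.log 2) * episodeGain M lam D alg t ω := by
  have hlam0 : 0 < lam := by linarith
  have hH0 : (0 : ℝ) < H := by exact_mod_cast hH
  have hd0 : (0 : ℝ) < d := by exact_mod_cast hd
  have hlog : 0 < Real.log 2 := Real.log_pos one_lt_two
  filter_upwards [halg t ht, posteriorAt_ae_eq M D alg hlam0 t] with ω ⟨_, hmin⟩ hpost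
  have hΛ := posDef_histGram M hlam0 D ω
  have hq := quadForm_histGram_inv_le_one M hlam D ω
  obtain ⟨π, hπ, hle⟩ := exists_randClosure_regret_sq_le M πs hC hΛ hq (histLin M D ω)
  have hscore := hmin hπ
  rw [hpost] at hscore
  simp only [Set.mem_ofPred_eq, score, ENNReal.coe_zero, add_zero] at hscore
  -- The Thompson score is at most K = 4Hd / log 2 even with zero information, as its regret is then
  -- 0 and 0/0 = 0. Conversely, finiteness of K rules out x/0 = ∞ for the played policy, so its
  -- squared regret is at most K times its information.
  have h1 := hscore.trans (ENNReal.div_le_of_le_mul hle)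
  rw [ENNReal.div_le_iff_le_mul (Or.inr ENNReal.ofReal_ne_top)
    (Or.inr (ENNReal.ofReal_pos.2 (by positivity)).ne'), infoGain_paramGaussian M _ hΛ _ hq] at h1
  rw [episodeRegret, hpost]
  exact h1

lemma sum_lintegral_episodeRegret_sq_le {lam : ℝ} (hlam : 1 ≤ lam) (hH : 1 ≤ H) (hd : 1 ≤ d)
    {C : Set (MarkovPolicy S A H)} (hC : ∀ w, πs.at w ∈ C) {T : ℕ}
    (halg : IsIDS M lam D πs (randClosure C) 0 T alg) :
    ∑ t ∈ Finset.range T, ∫⁻ ω, ENNReal.ofReal (episodeRegret M lam D πs alg t ω ^ 2)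
        ∂(histLaw M lam D alg t) ≤
      ENNReal.ofReal (4 * (H * d) / Real.log 2) *
        ∫⁻ ω, ENNReal.ofReal (potential M lam D ω) ∂(histLaw M lam D alg T) := by
  rw [lintegral_potential M D alg (by linarith), Finset.mul_sum]
  refine Finset.sum_le_sum fun t ht => ?_
  rw [← lintegral_const_mul' _ _ ENNReal.ofReal_ne_top]
  exact lintegral_mono_ae
    (ae_episodeRegret_sq_le M D πs alg hlam hH hd hC halg (Finset.mem_range.1 ht))

end Regret

/-- The Cauchy–Schwarz inequality for a sum of expectations under different laws. -/
lemma sum_integral_sq_le {Ω : ℕ → Type*} [∀ t, MeasurableSpace (Ω t)] (μ : ∀ t, Measure (Ω t))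
    [∀ t, IsProbabilityMeasure (μ t)] (X : ∀ t, Ω t → ℝ) (hX : ∀ t, Measurable (X t)) {T : ℕ}
    {b : ℝ} (hb : 0 ≤ b)
    (h : ∑ t ∈ Finset.range T, ∫⁻ ω, ENNReal.ofReal (X t ω ^ 2) ∂(μ t) ≤ ENNReal.ofReal b) :
    (∀ t < T, Integrable (X t) (μ t)) ∧
      ∑ t ∈ Finset.range T, ∫ ω, X t ω ∂(μ t) ≤ Real.sqrt (b * T) := by
  have hsq : ∀ t < T, Integrable (fun ω => X t ω ^ 2) (μ t) := fun t ht => by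
    refine ⟨((hX t).pow_const 2).aestronglyMeasurable, ?_⟩
    rw [hasFiniteIntegral_iff_ofReal (Filter.Eventually.of_forall fun ω => sq_nonneg _)]
    exact ((Finset.single_le_sum (f := fun t => ∫⁻ ω, ENNReal.ofReal (X t ω ^ 2) ∂(μ t))
      (fun _ _ => zero_le) (Finset.mem_range.2 ht)).trans h).trans_lt ENNReal.ofReal_lt_top
  have hint : ∀ t < T, Integrable (X t) (μ t) := fun t ht =>
    ((memLp_two_iff_integrable_sq (hX t).aestronglyMeasurable).2 (hsq t ht)).integrable
      one_le_two
  refine ⟨hint, ?_⟩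
  have hsum : ∑ t ∈ Finset.range T, ∫ ω, X t ω ^ 2 ∂(μ t) ≤ b := by
    rw [← ENNReal.ofReal_le_ofReal_iff hb, ENNReal.ofReal_sum_of_nonneg
      fun t _ => integral_nonneg fun ω => sq_nonneg _]
    refine (Finset.sum_le_sum fun t ht => le_of_eq ?_).trans h
    exact ofReal_integral_eq_lintegral_ofReal (hsq t (Finset.mem_range.1 ht))
      (Filter.Eventually.of_forall fun ω => sq_nonneg _)
  refine Real.le_sqrt_of_sq_le ?_
  -- Jensen within each episode, as nonnegativity of the variance; Cauchy–Schwarz over the episodes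
  -- follows.
  have hvar : ∀ t ∈ Finset.range T, (∫ ω, X t ω ∂(μ t)) ^ 2 ≤ ∫ ω, X t ω ^ 2 ∂(μ t) := by
    intro t ht
    have h0 := variance_nonneg (X t) (μ t)
    rw [variance_eq_sub ((memLp_two_iff_integrable_sq (hX t).aestronglyMeasurable).2
      (hsq t (Finset.mem_range.1 ht)))] at h0
    simpa using h0
  have hcs := sq_sum_le_card_mul_sum_sq (s := Finset.range T) (f := fun t => ∫ ω, X t ω ∂(μ t))
  rw [Finset.card_range] at hcs
  calc _ ≤ (T : ℝ) * ∑ t ∈ Finset.range T, (∫ ω, X t ω ∂(μ t)) ^ 2 := hcs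
    _ ≤ T * b := by gcongr; exact (Finset.sum_le_sum hvar).trans hsum
    _ = b * T := mul_comm _ _

end

end OffToOn

end

theorem theorem1 {S A : Type*} [MeasurableSpace S] [MeasurableSpace A] (H d T : ℕ)
    (hH : 1 ≤ H) (hd : 1 ≤ d) (hT : 1 ≤ T)
    (M : OffToOn.Model S A H d) (lam : ℝ) (hlam : 1 ≤ lam)
    (D : OffToOn.Dataset S A H) (hD : ∀ h, 1 ≤ D.n h)
    (πs : OffToOn.CtxPolicy (OffToOn.Param H d) S A H)
    (hopt : OffToOn.IsOptimalFamily M πs)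
    (C : Set (OffToOn.MarkovPolicy S A H)) (hC : ∀ w, πs.at w ∈ C)
    (alg : OffToOn.Algorithm S A H)
    (halg : OffToOn.IsIDS M lam D πs (OffToOn.randClosure C) 0 T alg) :
    (∀ t < T, MeasureTheory.Integrable (OffToOn.episodeRegret M lam D πs alg t)
        (OffToOn.histLaw M lam D alg t)) ∧
      OffToOn.bayesRegret M lam D πs alg T ≤
        Real.sqrt (2 / Real.log 2) * (H * d) *
          min (Real.sqrt (T * OffToOn.avgLog M lam D T))
            (T * Real.sqrt (OffToOn.coverage M lam D alg T / D.size)) := by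
  have hlam0 : 0 < lam := by linarith
  have hlog : 0 < Real.log 2 := Real.log_pos one_lt_two
  have hprob : ∀ t, IsProbabilityMeasure (OffToOn.histLaw M lam D alg t) := fun t =>
    Measure.isProbabilityMeasure_map (by fun_prop)
  have hmain := OffToOn.sum_lintegral_episodeRegret_sq_le M D πs alg hlam hH hd hC halg
  -- Common end of both bounds: q is L_N(T) in the first and T C†/N in the second.
  have hcs : ∀ q : ℝ, (∫⁻ ω, ENNReal.ofReal (OffToOn.potential M lam D ω)
        ∂(OffToOn.histLaw M lam D alg T)) ≤ ENNReal.ofReal (H * d / 2 * q) →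
      (∀ t < T, Integrable (OffToOn.episodeRegret M lam D πs alg t)
        (OffToOn.histLaw M lam D alg t)) ∧ OffToOn.bayesRegret M lam D πs alg T ≤
          Real.sqrt (2 / Real.log 2) * (H * d) * Real.sqrt (T * q) := by
    intro q hq
    -- Replacing q by its positive part avoids proving q ≥ 0: `Real.sqrt` vanishes on negative
    -- numbers, so the final bound is unchanged.
    have hq' : ENNReal.ofReal (H * d / 2 * q) ≤ ENNReal.ofReal (H * d / 2 * max q 0) :=
      ENNReal.ofReal_le_ofReal (by gcongr; exact le_max_left _ _)
    have h1 : (4 * (H * d) / Real.log 2) * (H * d / 2 * max q 0) * T =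
        2 / Real.log 2 * (H * d) ^ 2 * (T * max q 0) := by ring
    have h2 : Real.sqrt (T * max q 0) = Real.sqrt (T * q) := by
      rw [Real.sqrt_mul (by positivity), Real.sqrt_mul (by positivity)]
      congr 1
      rcases le_total q 0 with h | h
      · rw [max_eq_right h, Real.sqrt_zero, Real.sqrt_eq_zero_of_nonpos h]
      · rw [max_eq_left h]
    have h3 := OffToOn.sum_integral_sq_le (OffToOn.histLaw M lam D alg)
      (OffToOn.episodeRegret M lam D πs alg) (OffToOn.measurable_episodeRegret M lam D πs alg)
      (T := T) (b := (4 * (H * d) / Real.log 2) * (H * d / 2 * max q 0)) (by positivity) (by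
        rw [ENNReal.ofReal_mul (by positivity)]
        exact hmain.trans (by gcongr; exact hq.trans hq'))
    rwa [h1, Real.sqrt_mul (by positivity), Real.sqrt_mul (by positivity),
      Real.sqrt_sq (by positivity), h2] at h3
  obtain ⟨hint, hA⟩ := hcs (OffToOn.avgLog M lam D T) (by
    refine (lintegral_mono fun ω => ENNReal.ofReal_le_ofReal
      (OffToOn.potential_le_avgLog M D hlam0 hd hH ω)).trans (le_of_eq ?_)
    simp)
  obtain ⟨-, hB⟩ := hcs _ (OffToOn.lintegral_potential_le_coverage M D alg hlam0 hd hH hT hD)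
  refine ⟨hint, ?_⟩
  -- Here q carries a factor T, so √(T · q) becomes T √(C†/N).
  rw [← mul_assoc (T : ℝ), Real.sqrt_mul (by positivity),
    Real.sqrt_mul_self (by positivity)] at hB
  rw [mul_min_of_nonneg _ _ (by positivity)]
  exact le_min hA hB
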